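/- Let $\ell\ge 1$, let $\Omega\subset\mathbb R^\ell$ be a bounded open set with Lipschitz boundary $\partial\Omega$ (near each boundary point, $\Omega$ is, in suitable Cartesian coordinates, the region below the graph of a Lipschitz function), and let $P_0, P_1(1),\dots,P_\ell(1)\in\mathbb R^{m\times n}$ be constant matrices. Consider the first-order differential operator and its formal adjoint $$\mathcal F w = P_0 w+\sum_{k=1}^{\ell}P_k(1)\,\partial_k w,\qquad \mathcal F^* v = P_0^\top v-\sum_{k=1}^{\ell}P_k(1)^\top\,\partial_k v .$$ Let $v:\overline\Omega\to\mathbb R^m$ and $w:\overline\Omega\to\mathbb R^n$ be continuous on $\overline\Omega$ and continuously differentiable in $\Omega$, such that the function $v^\top\mathcal F w-w^\top\mathcal F^*v$ is Lebesgue integrable on $\Omega$ (which is automatic if the first partial derivatives are bounded or merely integrable). Then the outward unit normal $\hat n=(\hat n_1,\dots,\hat n_\ell)$ exists at almost every point of $\partial\Omega$ with respect to the surface measure $ds$ (the normalized $(\ell-1)$-dimensional Hausdorff measure), and, with $$P_\partial(s)=\sum_{k=1}^{\ell}P_k(1)^\top\,\hat n_k(s)\in\mathbb R^{n\times m},$$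 the function $w^\top P_\partial v$ is integrable on $\partial\Omega$ and $$\int_\Omega\left(v(x)^\top\mathcal F w(x)-w(x)^\top\mathcal F^*v(x)\right)dx=\int_{\partial\Omega}w(s)^\top P_\partial(s)\,v(s)\,ds .$$ -/

import Mathlib

open MeasureTheory Set Filter Topology
open scoped Matrix RealInnerProductSpace NNReal

/-- The partial derivative `∂ₖ f`, with respect to the `k`-th Cartesian coordinate. -/
noncomputable def partialDeriv {ℓ q : ℕ} (k : Fin ℓ)
    (f : EuclideanSpace ℝ (Fin ℓ) → Fin q → ℝ) : EuclideanSpace ℝ (Fin ℓ) → Fin q → ℝ :=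
  fun x => fderiv ℝ f x (EuclideanSpace.single k 1)

/-- The constant-coefficient operator of order `N`,
`F w = P₀ w + ∑ₖ ∑_{i = 1}^N Pₖ(i) ∂ₖ^i w`, with `m × n` matrices `P₀` and `Pₖ(i) = P k i`. -/
noncomputable def diffOp {ℓ m n : ℕ} (N : ℕ) (P₀ : Matrix (Fin m) (Fin n) ℝ)
    (P : Fin ℓ → ℕ → Matrix (Fin m) (Fin n) ℝ)
    (w : EuclideanSpace ℝ (Fin ℓ) → Fin n → ℝ) : EuclideanSpace ℝ (Fin ℓ) → Fin m → ℝ :=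
  fun x => P₀ *ᵥ w x + ∑ k, ∑ i ∈ Finset.Icc 1 N, P k i *ᵥ ((partialDeriv k)^[i] w) x

/-- The formal adjoint,
`F* v = P₀ᵀ v + ∑ₖ ∑_{i = 1}^N (-1)^i Pₖ(i)ᵀ ∂ₖ^i v`. -/
noncomputable def diffOpAdjoint {ℓ m n : ℕ} (N : ℕ) (P₀ : Matrix (Fin m) (Fin n) ℝ)
    (P : Fin ℓ → ℕ → Matrix (Fin m) (Fin n) ℝ)
    (v : EuclideanSpace ℝ (Fin ℓ) → Fin m → ℝ) : EuclideanSpace ℝ (Fin ℓ) → Fin n → ℝ :=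
  fun x => P₀ᵀ *ᵥ v x +
    ∑ k, ∑ i ∈ Finset.Icc 1 N, (-1 : ℝ) ^ i • ((P k i)ᵀ *ᵥ ((partialDeriv k)^[i] v) x)

/-- `Ω` is a bounded open set with Lipschitz boundary: near each of its boundary points, `Ω` is,
for some unit vector `e`, the region on the side `-e` of the graph, over the hyperplane
orthogonal to `e`, of a Lipschitz function. -/
structure IsBoundedLipschitzDomain {ℓ : ℕ} (Ω : Set (EuclideanSpace ℝ (Fin ℓ))) : Prop where
  isOpen : IsOpen Ω
  isBounded : Bornology.IsBounded Ω
  locally_subgraph : ∀ p ∈ frontier Ω, ∃ e : EuclideanSpace ℝ (Fin ℓ), ‖e‖ = 1 ∧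
    ∃ (K : ℝ≥0) (g : (ℝ ∙ e)ᗮ → ℝ), LipschitzWith K g ∧
      ∀ᶠ x in 𝓝 p, x ∈ Ω ↔ ⟪e, x⟫ < g ((ℝ ∙ e)ᗮ.orthogonalProjectionOnto x)

/-- `ν` is an outward unit normal vector to `Ω` at `s`: near `s`, the set `Ω` contains every cone
about `-ν`, and misses every cone about `ν`, of half-angle less than `π / 2`. In other words,
the hyperplane through `s` orthogonal to `ν` is tangent to `∂Ω` at `s`, and `Ω` lies on the
side of `-ν`. -/
def IsOutwardUnitNormal {ℓ : ℕ} (Ω : Set (EuclideanSpace ℝ (Fin ℓ)))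
    (s ν : EuclideanSpace ℝ (Fin ℓ)) : Prop :=
  ‖ν‖ = 1 ∧ ∀ ε > 0, ∀ᶠ x in 𝓝 s,
    (⟪ν, x - s⟫ < -(ε * ‖x - s‖) → x ∈ Ω) ∧ (ε * ‖x - s‖ < ⟪ν, x - s⟫ → x ∉ Ω)

open Classical in
/-- The outward unit normal vector `n̂(s)` to `Ω` at `s` (zero where there is none; where there is
one, it is unique). -/
noncomputable def outwardNormal {ℓ : ℕ} (Ω : Set (EuclideanSpace ℝ (Fin ℓ)))
    (s : EuclideanSpace ℝ (Fin ℓ)) : EuclideanSpace ℝ (Fin ℓ) :=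
  if h : ∃ ν, IsOutwardUnitNormal Ω s ν then h.choose else 0

/-- The `n × m` matrix `P_∂(s) = ∑ₖ Pₖ(1)ᵀ n̂ₖ(s)`. -/
noncomputable def boundaryMatrix {ℓ m n : ℕ} (P : Fin ℓ → ℕ → Matrix (Fin m) (Fin n) ℝ)
    (Ω : Set (EuclideanSpace ℝ (Fin ℓ))) (s : EuclideanSpace ℝ (Fin ℓ)) :
    Matrix (Fin n) (Fin m) ℝ :=
  ∑ k, outwardNormal Ω s k • (P k 1)ᵀ

/-- The surface measure on `∂Ω`: the `(ℓ - 1)`-dimensional Hausdorff measure, normalized so as to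
agree with Lebesgue measure on `(ℓ - 1)`-dimensional Euclidean space. -/
noncomputable def surfaceMeasure {ℓ : ℕ} (Ω : Set (EuclideanSpace ℝ (Fin ℓ))) :
    Measure (EuclideanSpace ℝ (Fin ℓ)) :=
  (Measure.euclideanHausdorffMeasure (ℓ - 1)).restrict (frontier Ω)

set_option linter.unusedSectionVars false

/-! Let `H` be the field with components `vᵀ Pₖ(1) w` (`greenField`). By the product rule the volume
integrand is `div H`, and `⟪H, n̂⟫` is the boundary integrand. The claim is thus the divergence
theorem on a Lipschitz domain for a field that is C¹ inside, continuous up to the boundary and has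
integrable divergence (`IsBoundedLipschitzDomain.setIntegral_divergence`).

A finite partition of unity localizes it. Patches inside `Ω` contribute nothing; on a boundary patch
`Ω` is the subgraph of a Lipschitz `g`. There the shear that straightens the graph preserves volume,
and a direction `u` splits into a tangent part, which integrates to zero over each translated graph,
and a multiple of `e`, handled by the fundamental theorem of calculus
(`setIntegral_subgraph_fderiv`). Lowering the graph by `t` and letting `t → 0` removes the need for
smoothness up to the boundary (`setIntegral_subgraph_divergence`).

The result is an integral of `⟪H, e - ∇g⟫` over the hyperplane. The area formula
`euclideanHausdorffMeasure_restrict_range_graphMap` makes it a surface integral, since `‖e - ∇g‖` is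
the area element and `e - ∇g`, normalized, is the outward normal wherever `g` is differentiable,
hence almost everywhere by Rademacher's theorem. -/

/-! ### Comparison of measures. -/

theorem MeasureTheory.Measure.le_of_countable_cover {α ι : Type*} [MeasurableSpace α] [Countable ι]
    {μ ν : Measure α} (T : ι → Set α) (hT : ∀ i, MeasurableSet (T i)) (hU : ⋃ i, T i = univ)
    (h : ∀ i S, MeasurableSet S → S ⊆ T i → μ S ≤ ν S) : μ ≤ ν := by
  rcases isEmpty_or_nonempty ι with hι | hι
  · have : (univ : Set α) = ∅ := by rw [← hU]; simp
    refine Measure.le_iff.2 fun S _ => ?_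
    have : S = ∅ := subset_empty_iff.1 (this ▸ subset_univ S)
    simp [this]
  obtain ⟨φ, hφ⟩ := exists_surjective_nat ι
  refine Measure.le_iff.2 fun S hS => ?_
  have hD : ∀ n, MeasurableSet (disjointed (T ∘ φ) n) :=
    fun n => MeasurableSet.disjointed (fun n => hT (φ n)) n
  have hcov : S = ⋃ n, S ∩ disjointed (T ∘ φ) n := by
    rw [← inter_iUnion, iUnion_disjointed]
    have : ⋃ n, (T ∘ φ) n = univ := by rw [← hU]; exact hφ.iUnion_comp T
    rw [this, inter_univ]
  have hdisj : Pairwise (Function.onFun Disjoint fun n => S ∩ disjointed (T ∘ φ) n) :=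
    fun i j hij => (disjoint_disjointed (T ∘ φ) hij).mono inter_subset_right inter_subset_right
  rw [hcov, measure_iUnion hdisj fun n => hS.inter (hD n),
    measure_iUnion hdisj fun n => hS.inter (hD n)]
  exact ENNReal.tsum_le_tsum fun n => h (φ n) _ (hS.inter (hD n))
    (inter_subset_right.trans (disjointed_subset (T ∘ φ) n))

/-- On `T` the map `f` factors through `h` by an `r`-Lipschitz map. Comparing two maps, rather than
assuming one Lipschitz, lets the lemma serve in both directions between a graph and its linear
approximation. -/
theorem euclideanHausdorffMeasure_image_le_of_edist_le {X Y Z : Type*}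
    [EMetricSpace Y] [MeasurableSpace Y] [BorelSpace Y]
    [EMetricSpace Z] [MeasurableSpace Z] [BorelSpace Z]
    {f : X → Y} {h : X → Z} {T : Set X} {r : ℝ≥0}
    (H : ∀ x ∈ T, ∀ y ∈ T, edist (f x) (f y) ≤ r * edist (h x) (h y)) (d : ℕ) :
    μHE[d] (f '' T) ≤ (r : ENNReal) ^ d * μHE[d] (h '' T) := by
  rcases T.eq_empty_or_nonempty with rfl | ⟨x₀, -⟩
  · simp
  have : Nonempty X := ⟨x₀⟩
  have hinv : ∀ x ∈ T, Function.invFunOn h T (h x) ∈ T ∧ h (Function.invFunOn h T (h x)) = h x :=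
    fun x hx => ⟨Function.invFunOn_mem ⟨x, hx, rfl⟩, Function.invFunOn_eq ⟨x, hx, rfl⟩⟩
  have hL : LipschitzOnWith r (fun z => f (Function.invFunOn h T z)) (h '' T) := by
    rintro _ ⟨x, hx, rfl⟩ _ ⟨y, hy, rfl⟩
    have := H _ (hinv x hx).1 _ (hinv y hy).1
    rwa [(hinv x hx).2, (hinv y hy).2] at this
  have himg : (fun z => f (Function.invFunOn h T z)) '' (h '' T) = f '' T := by
    rw [image_image]
    refine image_congr fun x hx => ?_
    have := H _ (hinv x hx).1 _ hx
    rw [(hinv x hx).2, edist_self, mul_zero, nonpos_iff_eq_zero] at this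
    exact edist_eq_zero.1 this
  have := hL.hausdorffMeasure_image_le (d := d) (by positivity)
  rw [himg, ENNReal.rpow_natCast] at this
  simp only [Measure.euclideanHausdorffMeasure_def, Measure.smul_apply, Measure.nnreal_smul_coe_apply]
  calc _ ≤ _ := mul_le_mul_right this _
    _ = _ := by ring

/-! ### Lipschitz graphs and their area formula. -/

section Graph

variable {E : Type*} [NormedAddCommGroup E] [InnerProductSpace ℝ E] [FiniteDimensional ℝ E]

/-- The parametrization of the graph of `g` over the hyperplane orthogonal to `e`. -/
def graphMap (e : E) (g : (ℝ ∙ e)ᗮ → ℝ) (y : (ℝ ∙ e)ᗮ) : E := (y : E) + g y • e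

/-- The vector `e - ∇ g (y)`, normal to the graph of `g`, whose length is the area element. -/
noncomputable def graphNormal (e : E) (g : (ℝ ∙ e)ᗮ → ℝ) (y : (ℝ ∙ e)ᗮ) : E :=
  e - ((gradient g y : (ℝ ∙ e)ᗮ) : E)

/-- The derivative of the parametrization of a graph, in terms of the derivative of the function. -/
noncomputable def graphDeriv (e : E) (a : (ℝ ∙ e)ᗮ →L[ℝ] ℝ) : (ℝ ∙ e)ᗮ →L[ℝ] E :=
  (ℝ ∙ e)ᗮ.subtypeL + a.smulRight e

variable {e : E} {g : (ℝ ∙ e)ᗮ → ℝ}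

@[simp] theorem graphDeriv_apply (a : (ℝ ∙ e)ᗮ →L[ℝ] ℝ) (y : (ℝ ∙ e)ᗮ) :
    graphDeriv e a y = (y : E) + a y • e := rfl

theorem inner_coe_orthogonal_right (y : (ℝ ∙ e)ᗮ) : ⟪e, (y : E)⟫ = 0 :=
  Submodule.mem_orthogonal_singleton_iff_inner_right.1 y.2

theorem inner_coe_orthogonal_left (y : (ℝ ∙ e)ᗮ) : ⟪(y : E), e⟫ = 0 :=
  Submodule.mem_orthogonal_singleton_iff_inner_left.1 y.2

theorem norm_sq_add_smul (he : ‖e‖ = 1) (y : (ℝ ∙ e)ᗮ) (c : ℝ) :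
    ‖(y : E) + c • e‖ ^ 2 = ‖y‖ ^ 2 + c ^ 2 := by
  rw [norm_add_sq_real, inner_smul_right, inner_coe_orthogonal_left, norm_smul, he]
  simp

theorem norm_le_norm_add_smul (he : ‖e‖ = 1) (y : (ℝ ∙ e)ᗮ) (c : ℝ) :
    ‖y‖ ≤ ‖(y : E) + c • e‖ := by
  refine (sq_le_sq₀ (norm_nonneg _) (norm_nonneg _)).1 ?_
  rw [norm_sq_add_smul he]
  nlinarith [sq_nonneg c]

theorem norm_sq_graphNormal (he : ‖e‖ = 1) (y : (ℝ ∙ e)ᗮ) :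
    ‖graphNormal e g y‖ ^ 2 = 1 + ‖gradient g y‖ ^ 2 := by
  rw [graphNormal, norm_sub_sq_real, inner_coe_orthogonal_right, he]
  simp

theorem one_le_norm_graphNormal (he : ‖e‖ = 1) (y : (ℝ ∙ e)ᗮ) : 1 ≤ ‖graphNormal e g y‖ := by
  have := norm_sq_graphNormal (g := g) he y
  nlinarith [norm_nonneg (graphNormal e g y), sq_nonneg ‖gradient g y‖]

/-- The Gram operator of the derivative is `x ↦ x + ⟪∇g, x⟫ ∇g`, a transvection with determinant `1
+ ‖∇g‖²`. -/
theorem normDet_graphDeriv (he : ‖e‖ = 1) (y : (ℝ ∙ e)ᗮ) :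
    (graphDeriv e (fderiv ℝ g y)).toLinearMap.normDet = ‖graphNormal e g y‖ := by
  rw [← sq_eq_sq₀ (LinearMap.normDet_nonneg _) (norm_nonneg _), norm_sq_graphNormal he]
  have h := (graphDeriv e (fderiv ℝ g y)).toLinearMap.normDet_sq
  simp only [RCLike.ofReal_real_eq_id, id] at h
  rw [h]
  have : LinearMap.adjoint (graphDeriv e (fderiv ℝ g y)).toLinearMap ∘ₗ
      (graphDeriv e (fderiv ℝ g y)).toLinearMap =
      LinearMap.transvection (fderiv ℝ g y).toLinearMap (gradient g y) := by
    refine LinearMap.ext fun x => ext_inner_right ℝ fun z => ?_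
    have h1 : ⟪gradient g y, z⟫ = fderiv ℝ g y z := by
      rw [gradient, InnerProductSpace.toDual_symm_apply]
    simp only [LinearMap.comp_apply, LinearMap.adjoint_inner_left, ContinuousLinearMap.coe_coe,
      graphDeriv_apply, LinearMap.transvection.apply, inner_add_left, inner_add_right,
      inner_smul_left, inner_smul_right, inner_coe_orthogonal_left, inner_coe_orthogonal_right,
      h1, Submodule.coe_inner, real_inner_self_eq_norm_sq, he]
    simp [mul_comm]
  rw [this, LinearMap.transvection.det]
  congr 1
  rw [← real_inner_self_eq_norm_sq, gradient, InnerProductSpace.toDual_symm_apply]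
  rfl

theorem hasFDerivAt_graphMap {y : (ℝ ∙ e)ᗮ} (h : DifferentiableAt ℝ g y) :
    HasFDerivAt (graphMap e g) (graphDeriv e (fderiv ℝ g y)) y :=
  ((ℝ ∙ e)ᗮ.subtypeL.hasFDerivAt).add (h.hasFDerivAt.smul_const e)

theorem orthogonalProjectionOnto_add_smul (y : (ℝ ∙ e)ᗮ) (c : ℝ) :
    (ℝ ∙ e)ᗮ.orthogonalProjectionOnto ((y : E) + c • e) = y := by
  rw [map_add, Submodule.orthogonalProjectionOnto_mem_subspace_eq_self, map_smul]
  simp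

theorem orthogonalProjectionOnto_graphMap (y : (ℝ ∙ e)ᗮ) :
    (ℝ ∙ e)ᗮ.orthogonalProjectionOnto (graphMap e g y) = y :=
  orthogonalProjectionOnto_add_smul y _

theorem inner_add_smul_self (he : ‖e‖ = 1) (y : (ℝ ∙ e)ᗮ) (c : ℝ) : ⟪e, (y : E) + c • e⟫ = c := by
  rw [inner_add_right, inner_coe_orthogonal_right, inner_smul_right, real_inner_self_eq_norm_sq, he]
  simp

theorem orthogonalProjectionOnto_add_inner_smul (he : ‖e‖ = 1) (x : E) :
    ((ℝ ∙ e)ᗮ.orthogonalProjectionOnto x : E) + ⟪e, x⟫ • e = x := by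
  have h1 := Submodule.starProjection_add_starProjection_orthogonal (K := ℝ ∙ e) x
  rw [Submodule.starProjection_unit_singleton ℝ he, add_comm] at h1
  exact h1

theorem continuous_graphMap (hg : Continuous g) : Continuous (graphMap e g) := by
  unfold graphMap; fun_prop

theorem injective_graphMap : Function.Injective (graphMap e g) :=
  Function.LeftInverse.injective (g := (ℝ ∙ e)ᗮ.orthogonalProjectionOnto)
    orthogonalProjectionOnto_graphMap

theorem range_graphMap (he : ‖e‖ = 1) :
    range (graphMap e g) = {x | ⟪e, x⟫ = g ((ℝ ∙ e)ᗮ.orthogonalProjectionOnto x)} := by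
  ext x
  constructor
  · rintro ⟨y, rfl⟩
    rw [mem_ofPred_eq, orthogonalProjectionOnto_graphMap, graphMap, inner_add_smul_self he]
  · intro h
    refine ⟨(ℝ ∙ e)ᗮ.orthogonalProjectionOnto x, ?_⟩
    rw [graphMap, ← (show _ = _ from h), orthogonalProjectionOnto_add_inner_smul he]

theorem lipschitzWith_graphMap {K : ℝ≥0} (he : ‖e‖ = 1) (hg : LipschitzWith K g) :
    LipschitzWith (1 + K) (graphMap e g) := by
  refine LipschitzWith.add (LipschitzWith.subtype_val _) ?_
  refine LipschitzWith.of_dist_le_mul fun x y => ?_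
  rw [dist_eq_norm, ← sub_smul, norm_smul, he, mul_one]
  simpa [dist_eq_norm] using hg.dist_le_mul x y

variable [MeasurableSpace E] [BorelSpace E]

theorem measurableEmbedding_graphMap (hg : Continuous g) : MeasurableEmbedding (graphMap e g) :=
  (continuous_graphMap hg).measurableEmbedding injective_graphMap

theorem measurable_gradient : Measurable (gradient g) := by
  unfold gradient
  exact (LinearIsometryEquiv.continuous _).measurable.comp (measurable_fderiv ℝ g)

theorem measurable_graphNormal : Measurable (graphNormal e g) :=
  Measurable.const_sub (measurable_subtype_coe.comp measurable_gradient) e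

/-- The linear map `graphDeriv e a` never shrinks lengths, so an error of `(1 - r⁻¹) ‖x - y‖` is at
most that fraction of the length of the linear image. The tolerance therefore does not depend on the
slope `a`. -/
theorem edist_graphMap_comparison {r : ℝ≥0} (hr : 1 < r) (he : ‖e‖ = 1)
    {a : (ℝ ∙ e)ᗮ →L[ℝ] ℝ} {T : Set (ℝ ∙ e)ᗮ}
    (h : ApproximatesLinearOn (graphMap e g) (graphDeriv e a) T (1 - r⁻¹)) :
    ∀ x ∈ T, ∀ y ∈ T,
      edist (graphMap e g x) (graphMap e g y) ≤ r * edist (graphDeriv e a x) (graphDeriv e a y) ∧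
      edist (graphDeriv e a x) (graphDeriv e a y) ≤ r * edist (graphMap e g x) (graphMap e g y) := by
  intro x hx y hy
  have hr' : (1 : ℝ) < r := hr
  have hinv : (r : ℝ) * (r : ℝ)⁻¹ = 1 := mul_inv_cancel₀ (by positivity)
  have hinv1 : (r : ℝ)⁻¹ < 1 := inv_lt_one_of_one_lt₀ hr'
  have hinv0 : 0 < (r : ℝ)⁻¹ := by positivity
  have h1 := h x hx y hy
  rw [NNReal.coe_sub (inv_le_one_of_one_le₀ hr.le)] at h1
  have h2 : ‖x - y‖ ≤ ‖graphDeriv e a (x - y)‖ := norm_le_norm_add_smul he _ _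
  have h3 : graphDeriv e a (x - y) = graphDeriv e a x - graphDeriv e a y := map_sub _ _ _
  rw [h3] at h1 h2
  simp only [NNReal.coe_one, NNReal.coe_inv] at h1
  set p := graphMap e g x - graphMap e g y
  set q := graphDeriv e a x - graphDeriv e a y
  have h4 : ‖p - q‖ ≤ (1 - (r : ℝ)⁻¹) * ‖q‖ :=
    h1.trans (mul_le_mul_of_nonneg_left h2 (by linarith))
  have h5 : ‖p‖ ≤ r * ‖q‖ := by
    have : ‖p‖ ≤ ‖p - q‖ + ‖q‖ := by simpa using norm_add_le (p - q) q
    have h6 : 2 - (r : ℝ)⁻¹ ≤ r := by nlinarith [sq_nonneg ((r : ℝ) - 1)]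
    nlinarith [norm_nonneg q, mul_le_mul_of_nonneg_right h6 (norm_nonneg q)]
  have h6 : ‖q‖ ≤ r * ‖p‖ := by
    have : ‖q‖ ≤ ‖p - q‖ + ‖p‖ := by
      have := norm_sub_le p (p - q)
      rw [sub_sub_cancel] at this; linarith
    have h7 : (r : ℝ)⁻¹ * ‖q‖ ≤ ‖p‖ := by linarith
    calc ‖q‖ = r * ((r : ℝ)⁻¹ * ‖q‖) := by rw [← mul_assoc, hinv, one_mul]
      _ ≤ _ := by gcongr
  constructor
  · rw [edist_dist, edist_dist, dist_eq_norm, dist_eq_norm, ← ENNReal.ofReal_coe_nnreal,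
      ← ENNReal.ofReal_mul (by positivity)]
    exact ENNReal.ofReal_le_ofReal h5
  · rw [edist_dist, edist_dist, dist_eq_norm, dist_eq_norm, ← ENNReal.ofReal_coe_nnreal,
      ← ENNReal.ofReal_mul (by positivity)]
    exact ENNReal.ofReal_le_ofReal h6

/-- Comparison with the linear image costs `r ^ d`; one more factor `r` pays for treating the area
element as constant, since on `T` and at `y` it stays in a window of ratio `r`. -/
theorem graph_area_comparison_of_approximatesLinearOn {r : ℝ≥0} (hr : 1 < r) (he : ‖e‖ = 1)
    {y : (ℝ ∙ e)ᗮ} {T : Set (ℝ ∙ e)ᗮ} {k : ℕ} (hT : MeasurableSet T)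
    (h : ApproximatesLinearOn (graphMap e g) (graphDeriv e (fderiv ℝ g y)) T (1 - r⁻¹))
    (hy : ‖graphNormal e g y‖ ∈ Ico ((r : ℝ) ^ k) (r ^ (k + 1)))
    (hT' : ∀ x ∈ T, ‖graphNormal e g x‖ ∈ Ico ((r : ℝ) ^ k) (r ^ (k + 1))) :
    μHE[Module.finrank ℝ (ℝ ∙ e)ᗮ] (graphMap e g '' T) ≤
        (r : ENNReal) ^ (Module.finrank ℝ (ℝ ∙ e)ᗮ + 1) *
          ∫⁻ x in T, ENNReal.ofReal ‖graphNormal e g x‖ ∧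
      ∫⁻ x in T, ENNReal.ofReal ‖graphNormal e g x‖ ≤
        (r : ENNReal) ^ (Module.finrank ℝ (ℝ ∙ e)ᗮ + 1) *
          μHE[Module.finrank ℝ (ℝ ∙ e)ᗮ] (graphMap e g '' T) := by
  set d := Module.finrank ℝ (ℝ ∙ e)ᗮ
  have hvol := (graphDeriv e (fderiv ℝ g y)).toLinearMap.euclideanHausdorffMeasure_image_eq_normDet_mul_volume T
  rw [normDet_graphDeriv he] at hvol
  have key : ∀ a b : ℝ, a ∈ Ico ((r : ℝ) ^ k) (r ^ (k + 1)) → b ∈ Ico ((r : ℝ) ^ k) (r ^ (k + 1)) →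
      ENNReal.ofReal a ≤ r * ENNReal.ofReal b := by
    intro a b ha hb
    rw [← ENNReal.ofReal_coe_nnreal, ← ENNReal.ofReal_mul (by positivity)]
    refine ENNReal.ofReal_le_ofReal (ha.2.le.trans ?_)
    rw [pow_succ, mul_comm]
    gcongr
    exact hb.1
  have hcmp := edist_graphMap_comparison hr he h
  have h1 := euclideanHausdorffMeasure_image_le_of_edist_le (fun x hx y hy => (hcmp x hx y hy).1) d
  have h2 := euclideanHausdorffMeasure_image_le_of_edist_le (fun x hx y hy => (hcmp x hx y hy).2) d
  have hvol' : μHE[d] (graphDeriv e (fderiv ℝ g y) '' T) =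
    ENNReal.ofReal ‖graphNormal e g y‖ * volume T := hvol
  constructor
  · refine h1.trans ?_
    rw [hvol', pow_succ, mul_assoc]
    refine mul_le_mul_right ?_ _
    rw [← setLIntegral_const, ← lintegral_const_mul' _ _ ENNReal.coe_ne_top]
    exact setLIntegral_mono' hT fun x hx => key _ _ hy (hT' x hx)
  · calc ∫⁻ x in T, ENNReal.ofReal ‖graphNormal e g x‖
        ≤ ∫⁻ x in T, r * ENNReal.ofReal ‖graphNormal e g y‖ :=
          setLIntegral_mono' hT fun x hx => key _ _ (hT' x hx) hy
      _ = r * μHE[d] (graphDeriv e (fderiv ℝ g y) '' T) := by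
          rw [setLIntegral_const, hvol', mul_assoc]
      _ ≤ r * ((r : ENNReal) ^ d * μHE[d] (graphMap e g '' T)) := by gcongr
      _ = _ := by ring

theorem graph_area_comparison {r K : ℝ≥0} (hr : 1 < r) (he : ‖e‖ = 1) (hg : LipschitzWith K g) :
    Measure.comap (graphMap e g) μHE[Module.finrank ℝ (ℝ ∙ e)ᗮ] ≤
        (r : ENNReal) ^ (Module.finrank ℝ (ℝ ∙ e)ᗮ + 1) •
          volume.withDensity (fun y => ENNReal.ofReal ‖graphNormal e g y‖) ∧
      volume.withDensity (fun y => ENNReal.ofReal ‖graphNormal e g y‖) ≤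
        (r : ENNReal) ^ (Module.finrank ℝ (ℝ ∙ e)ᗮ + 1) •
          Measure.comap (graphMap e g) μHE[Module.finrank ℝ (ℝ ∙ e)ᗮ] := by
  set d := Module.finrank ℝ (ℝ ∙ e)ᗮ
  have hemb := measurableEmbedding_graphMap (e := e) hg.continuous
  set D : Set (ℝ ∙ e)ᗮ := {y | DifferentiableAt ℝ g y} with hD
  have hDm : MeasurableSet D := measurableSet_of_differentiableAt ℝ g
  have hD0 : volume Dᶜ = 0 := hg.ae_differentiableAt
  -- Geometric windows for the area element; they exhaust `D` because it is at least 1.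
  set s : ℕ → Set (ℝ ∙ e)ᗮ :=
    fun k => D ∩ {y | ‖graphNormal e g y‖ ∈ Ico ((r : ℝ) ^ k) (r ^ (k + 1))} with hs
  have hsm : ∀ k, MeasurableSet (s k) := fun k =>
    hDm.inter (measurable_graphNormal.norm measurableSet_Ico)
  have hrinv : (1 - r⁻¹ : ℝ≥0) ≠ 0 := (tsub_pos_of_lt (inv_lt_one_of_one_lt₀ hr)).ne'
  have hpart := fun k => exists_partition_approximatesLinearOn_of_hasFDerivWithinAt
    (graphMap e g) (s k) (fun y => graphDeriv e (fderiv ℝ g y))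
    (fun x hx => (hasFDerivAt_graphMap hx.1).hasFDerivWithinAt) (fun _ => 1 - r⁻¹) (fun _ => hrinv)
  choose t A _ htm hcov happ hA using hpart
  -- The index `none` carries the null set where `g` is not differentiable; its image is null
  -- because `graphMap` is Lipschitz.
  let T : Option (ℕ × ℕ) → Set (ℝ ∙ e)ᗮ := fun o => o.elim Dᶜ fun p => s p.1 ∩ t p.1 p.2
  have hT : ∀ o, MeasurableSet (T o) := by
    rintro (_ | p)
    · exact hDm.compl
    · exact (hsm _).inter (htm _ _)
  have hTU : ⋃ o, T o = univ := by
    refine eq_univ_of_forall fun x => mem_iUnion.2 ?_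
    by_cases hx : x ∈ D
    · obtain ⟨k, hk⟩ := exists_nat_pow_near (one_le_norm_graphNormal (g := g) he x)
        (show (1 : ℝ) < r from hr)
      have hxs : x ∈ s k := ⟨hx, hk⟩
      obtain ⟨n, hn⟩ := mem_iUnion.1 (hcov k hxs)
      exact ⟨some (k, n), hxs, hn⟩
    · exact ⟨none, hx⟩
  have main : ∀ o S, MeasurableSet S → S ⊆ T o →
      μHE[d] (graphMap e g '' S) ≤ (r : ENNReal) ^ (d + 1) *
          ∫⁻ x in S, ENNReal.ofReal ‖graphNormal e g x‖ ∧
      ∫⁻ x in S, ENNReal.ofReal ‖graphNormal e g x‖ ≤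
        (r : ENNReal) ^ (d + 1) * μHE[d] (graphMap e g '' S) := by
    rintro (_ | ⟨k, n⟩) S hS hST
    · have h0 : volume S = 0 := measure_mono_null hST hD0
      have h1 : μHE[d] (graphMap e g '' S) = 0 := by
        have h2 := euclideanHausdorffMeasure_image_le_of_edist_le (h := (id : (ℝ ∙ e)ᗮ → _)) (T := S)
          (fun x _ y _ => (lipschitzWith_graphMap he hg) x y) d
        rw [image_id, InnerProductSpace.euclideanHausdorffMeasure_eq_volume, h0, mul_zero] at h2
        exact nonpos_iff_eq_zero.1 h2
      rw [h1, setLIntegral_measure_zero _ _ h0]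
      simp
    · rcases S.eq_empty_or_nonempty with rfl | ⟨x, hx⟩
      · simp
      -- The base point `y` need not lie in the piece; it is enough that it lies in the same window
      -- `s k`.
      obtain ⟨y, hy, hAy⟩ := hA k ⟨x, (hST hx).1⟩ n
      have h1 := happ k n
      rw [hAy] at h1
      exact graph_area_comparison_of_approximatesLinearOn hr he hS (h1.mono_set hST) hy.2
        fun x hx => (hST hx).1.2
  constructor
  · refine Measure.le_of_countable_cover T hT hTU fun o S hS hST => ?_
    rw [hemb.comap_apply, Measure.smul_apply, withDensity_apply _ hS]
    exact (main o S hS hST).1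
  · refine Measure.le_of_countable_cover T hT hTU fun o S hS hST => ?_
    rw [Measure.smul_apply, withDensity_apply _ hS, hemb.comap_apply]
    exact (main o S hS hST).2

theorem ENNReal.le_of_forall_one_lt_pow_mul {a b : ENNReal} (n : ℕ)
    (h : ∀ r : ℝ≥0, 1 < r → a ≤ (r : ENNReal) ^ n * b) : a ≤ b := by
  have hlim : Tendsto (fun r : ℝ≥0 => (r : ENNReal) ^ n * b) (𝓝[>] 1) (𝓝 (((1 : ℝ≥0) : ENNReal) ^ n * b)) := by
    -- The limit of `r ^ n` is nonzero, so `b = ⊤` is allowed.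
    refine ENNReal.Tendsto.mul_const ?_ (Or.inl (by simp))
    exact ((ENNReal.continuous_pow n).comp ENNReal.continuous_coe).continuousWithinAt
  have := ge_of_tendsto hlim (eventually_nhdsWithin_of_forall fun r hr => h r hr)
  simpa using this

/-- The area formula for the graph of a Lipschitz function. -/
theorem euclideanHausdorffMeasure_restrict_range_graphMap {K : ℝ≥0} (he : ‖e‖ = 1)
    (hg : LipschitzWith K g) :
    (μHE[Module.finrank ℝ (ℝ ∙ e)ᗮ]).restrict (range (graphMap e g)) =
      (volume.withDensity fun y => ENNReal.ofReal ‖graphNormal e g y‖).map (graphMap e g) := by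
  have hemb := measurableEmbedding_graphMap (e := e) hg.continuous
  rw [← hemb.map_comap]
  congr 1
  refine le_antisymm ?_ ?_
  · refine Measure.le_iff.2 fun S _ => ENNReal.le_of_forall_one_lt_pow_mul
      (Module.finrank ℝ (ℝ ∙ e)ᗮ + 1) fun r hr => ?_
    exact (graph_area_comparison hr he hg).1 S
  · refine Measure.le_iff.2 fun S _ => ENNReal.le_of_forall_one_lt_pow_mul
      (Module.finrank ℝ (ℝ ∙ e)ᗮ + 1) fun r hr => ?_
    exact (graph_area_comparison hr he hg).2 S

end Graph

/-! ### Straightening the graph; the divergence theorem in one direction. -/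

section Shear

variable {E : Type*} [NormedAddCommGroup E] [InnerProductSpace ℝ E] [FiniteDimensional ℝ E]
  {e : E} {g : (ℝ ∙ e)ᗮ → ℝ}

/-- The coordinates on `E` given by the base point in the hyperplane orthogonal to `e` and by the
signed height above the graph of `g`. -/
def shearMap (e : E) (g : (ℝ ∙ e)ᗮ → ℝ) (p : (ℝ ∙ e)ᗮ × ℝ) : E := graphMap e (fun y => g y + p.2) p.1

/-- The strict subgraph of `g` in the direction `e`. -/
def subgraph (e : E) (g : (ℝ ∙ e)ᗮ → ℝ) : Set E :=
  {x | ⟪e, x⟫ < g ((ℝ ∙ e)ᗮ.orthogonalProjectionOnto x)}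

theorem isOpen_subgraph (hg : Continuous g) : IsOpen (subgraph e g) :=
  isOpen_lt (by fun_prop) (by fun_prop)

theorem isClosed_closedSubgraph (hg : Continuous g) :
    IsClosed {x : E | ⟪e, x⟫ ≤ g ((ℝ ∙ e)ᗮ.orthogonalProjectionOnto x)} :=
  isClosed_le (by fun_prop) (by fun_prop)

theorem continuous_shearMap (hg : Continuous g) : Continuous (shearMap e g) := by
  unfold shearMap graphMap; fun_prop

theorem injective_shearMap (he : ‖e‖ = 1) : Function.Injective (shearMap e g) := by
  rintro ⟨y, z⟩ ⟨y', z'⟩ h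
  have h1 := congrArg (ℝ ∙ e)ᗮ.orthogonalProjectionOnto h
  have h2 := congrArg (fun x => ⟪e, x⟫) h
  simp only [shearMap, orthogonalProjectionOnto_graphMap] at h1
  simp only [shearMap, graphMap, inner_add_smul_self he] at h2
  subst h1
  simpa using h2

theorem shearMap_preimage_subgraph (he : ‖e‖ = 1) :
    shearMap e g ⁻¹' subgraph e g = univ ×ˢ Iio 0 := by
  ext ⟨y, z⟩
  simp only [mem_preimage, subgraph, mem_ofPred_eq, shearMap, orthogonalProjectionOnto_graphMap]
  simp [graphMap, inner_add_smul_self he]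

theorem gradient_add_const (c : ℝ) : gradient (fun y => g y + c) = gradient g := by
  ext1 y; rw [gradient, gradient, fderiv_add_const]

theorem inner_gradient (y i : (ℝ ∙ e)ᗮ) : ⟪gradient g y, i⟫ = fderiv ℝ g y i := by
  rw [gradient, InnerProductSpace.toDual_symm_apply]

theorem inner_graphNormal (y : (ℝ ∙ e)ᗮ) (u : E) :
    ⟪u, graphNormal e g y⟫ =
      ⟪e, u⟫ - fderiv ℝ g y ((ℝ ∙ e)ᗮ.orthogonalProjectionOnto u) := by
  rw [graphNormal, inner_sub_right, real_inner_comm, ← inner_gradient]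
  congr 1
  rw [real_inner_comm, Submodule.inner_orthogonalProjectionOnto_eq_of_mem_left]

theorem norm_graphNormal_le {K : ℝ≥0} (he : ‖e‖ = 1) (hg : LipschitzWith K g) (y : (ℝ ∙ e)ᗮ) :
    ‖graphNormal e g y‖ ≤ 1 + K := by
  refine (norm_sub_le _ _).trans ?_
  rw [he, ← Submodule.coe_norm, gradient, LinearIsometryEquiv.norm_map]
  gcongr
  exact norm_fderiv_le_of_lipschitz ℝ hg

theorem isClosedEmbedding_graphMap (hg : Continuous g) : IsClosedEmbedding (graphMap e g) :=
  Function.LeftInverse.isClosedEmbedding (f := (ℝ ∙ e)ᗮ.orthogonalProjectionOnto)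
    orthogonalProjectionOnto_graphMap (by fun_prop) (continuous_graphMap hg)

variable [MeasurableSpace E] [BorelSpace E]

theorem measurePreserving_add_smul (he : ‖e‖ = 1) :
    MeasurePreserving (fun p : (ℝ ∙ e)ᗮ × ℝ => (p.1 : E) + p.2 • e) := by
  have h1 := (LinearIsometryEquiv.toSpanUnitSingleton (𝕜 := ℝ) e he).measurePreserving
  have h2 := h1.prod (MeasurePreserving.id (volume : Measure (ℝ ∙ e)ᗮ))
  have h3 := h2.comp (Measure.measurePreserving_swap (μ := (volume : Measure (ℝ ∙ e)ᗮ))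
    (ν := (volume : Measure ℝ)))
  have h4 := (WithLp.volume_preserving_toLp (ℝ ∙ e) (ℝ ∙ e)ᗮ).comp h3
  have h5 := ((ℝ ∙ e).orthogonalDecomposition.symm.measurePreserving).comp h4
  convert! h5 using 1
  ext p
  simp [Submodule.orthogonalDecomposition_symm_apply, add_comm]

/-- Each vertical fibre is merely translated, so no differentiability of `g` enters. -/
theorem measurePreserving_shearMap (he : ‖e‖ = 1) (hg : Continuous g) :
    MeasurePreserving (shearMap e g) := by
  have h1 : MeasurePreserving (fun p : (ℝ ∙ e)ᗮ × ℝ => (id p.1, g p.1 + p.2)) :=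
    (MeasurePreserving.id (volume : Measure (ℝ ∙ e)ᗮ)).skew_product (g := fun y z => g y + z)
      (by fun_prop) (Eventually.of_forall fun y => (measurePreserving_add_left volume (g y)).map_eq)
  exact (measurePreserving_add_smul he).comp h1

theorem measurableEmbedding_shearMap (he : ‖e‖ = 1) (hg : Continuous g) :
    MeasurableEmbedding (shearMap e g) :=
  (continuous_shearMap hg).measurableEmbedding (injective_shearMap he)

/-- Almost everywhere the integrand is the derivative along `i` of `f ∘ graphMap e g`, which is
Lipschitz with compact support; integrate by parts against the constant 1. -/
theorem integral_fderiv_graphMap_tangent {K : ℝ≥0} (he : ‖e‖ = 1) (hg : LipschitzWith K g)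
    {f : E → ℝ} (hf : ContDiff ℝ 1 f) (hfc : HasCompactSupport f) (i : (ℝ ∙ e)ᗮ) :
    ∫ y, fderiv ℝ f (graphMap e g y) ((i : E) + fderiv ℝ g y i • e) = 0 := by
  obtain ⟨C, hC⟩ := hf.lipschitzWith_of_hasCompactSupport hfc one_ne_zero
  have hL := hC.comp (lipschitzWith_graphMap he hg)
  have hcs : HasCompactSupport (f ∘ graphMap e g) :=
    hfc.comp_isClosedEmbedding (isClosedEmbedding_graphMap hg.continuous)
  -- Integration by parts reverses the direction, hence the start from `-i`.
  have h1 := (LipschitzWith.const (1 : ℝ)).integral_lineDeriv_mul_eq (μ := volume)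
    (hL.weaken le_rfl) hcs (-i)
  have h2 : ∀ᵐ y : (ℝ ∙ e)ᗮ, fderiv ℝ f (graphMap e g y) ((i : E) + fderiv ℝ g y i • e) =
      lineDeriv ℝ (f ∘ graphMap e g) y (- -i) * 1 := by
    filter_upwards [hg.ae_differentiableAt] with y hy
    have h3 : HasFDerivAt (f ∘ graphMap e g) _ y :=
      ((hf.differentiable one_ne_zero _).hasFDerivAt).comp y (hasFDerivAt_graphMap hy)
    rw [(h3.hasLineDerivAt _).lineDeriv]
    simp
  rw [integral_congr_ae h2, ← h1]
  have : ∀ x : (ℝ ∙ e)ᗮ, lineDeriv ℝ (fun _ : (ℝ ∙ e)ᗮ => (1 : ℝ)) x (-i) = 0 := fun x => by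
    simp [lineDeriv]
  simp [this]

theorem integral_Iio_fderiv_shearMap {f : E → ℝ} (hf : ContDiff ℝ 1 f)
    (hfc : HasCompactSupport f) (he : ‖e‖ = 1) (y : (ℝ ∙ e)ᗮ) :
    ∫ z in Iio (0 : ℝ), fderiv ℝ f (shearMap e g (y, z)) e = f (graphMap e g y) := by
  have hc : IsClosedEmbedding (fun z : ℝ => (y : E) + (g y + z) • e) :=
    Function.LeftInverse.isClosedEmbedding (f := fun x : E => ⟪e, x⟫ - g y)
      (fun z => by simp [inner_add_smul_self he]) (by fun_prop) (by fun_prop)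
  have h1 := (hfc.comp_isClosedEmbedding hc).integral_Iic_deriv_eq
    (hf.comp (by fun_prop)) 0
  rw [integral_Iic_eq_integral_Iio] at h1
  simp only [Function.comp, add_zero] at h1
  rw [graphMap, ← h1]
  refine integral_congr_ae (Eventually.of_forall fun z => ?_)
  have h2 : HasDerivAt (fun z : ℝ => (y : E) + (g y + z) • e) e z := by
    have := ((((hasDerivAt_id z).const_add (g y)).smul_const e).const_add (y : E))
    simpa using this
  have h3 := ((hf.differentiable one_ne_zero _).hasFDerivAt).comp_hasDerivAt z h2
  exact h3.deriv.symm

theorem integrable_fderiv_shearMap {f : E → ℝ} (hf : ContDiff ℝ 1 f)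
    (hfc : HasCompactSupport f) (he : ‖e‖ = 1) (hg : Continuous g) (u : E) (s : Set ℝ) :
    Integrable (fun p => fderiv ℝ f (shearMap e g p) u)
      ((volume : Measure (ℝ ∙ e)ᗮ).prod (volume.restrict s)) := by
  have h1 : Integrable (fun x => fderiv ℝ f x u) := by
    refine Continuous.integrable_of_hasCompactSupport ?_ (hfc.fderiv_apply ℝ u)
    exact (hf.continuous_fderiv one_ne_zero).clm_apply continuous_const
  have h2 := (measurePreserving_shearMap he hg).integrable_comp_of_integrable h1
  refine h2.mono_measure ?_
  rw [Measure.volume_eq_prod]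
  exact Measure.prod_mono le_rfl Measure.restrict_le_self

/-- The divergence theorem for a compactly supported function on the subgraph of a Lipschitz
function, one direction `u` at a time. -/
theorem setIntegral_subgraph_fderiv {K : ℝ≥0} (he : ‖e‖ = 1) (hg : LipschitzWith K g)
    {f : E → ℝ} (hf : ContDiff ℝ 1 f) (hfc : HasCompactSupport f) (u : E) :
    ∫ x in subgraph e g, fderiv ℝ f x u =
      ∫ y, f (graphMap e g y) * ⟪u, graphNormal e g y⟫ := by
  set i := (ℝ ∙ e)ᗮ.orthogonalProjectionOnto u with hi
  have hu : (i : E) + ⟪e, u⟫ • e = u := orthogonalProjectionOnto_add_inner_smul he u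
  rw [← (measurePreserving_shearMap he hg.continuous).setIntegral_preimage_emb
    (measurableEmbedding_shearMap he hg.continuous), shearMap_preimage_subgraph he,
    Measure.volume_eq_prod, ← Measure.prod_restrict, Measure.restrict_univ]
  have hint := integrable_fderiv_shearMap hf hfc he hg.continuous (s := Iio 0)
  have hbound : ∀ y, ‖fderiv ℝ g y i‖ ≤ K * ‖i‖ := fun y =>
    ((fderiv ℝ g y).le_opNorm i).trans (by gcongr; exact norm_fderiv_le_of_lipschitz ℝ hg)
  have hmeas : Measurable fun y => fderiv ℝ g y i :=
    measurable_fderiv_apply_const ℝ g i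
  have hint1 : Integrable (fun p : (ℝ ∙ e)ᗮ × ℝ =>
      fderiv ℝ g p.1 i * fderiv ℝ f (shearMap e g p) e)
      ((volume : Measure (ℝ ∙ e)ᗮ).prod (volume.restrict (Iio 0))) :=
    (hint e).bdd_mul (c := K * ‖i‖) (hmeas.comp measurable_fst).aestronglyMeasurable
      (Eventually.of_forall fun p => hbound p.1)
  have hintT : Integrable (fun p : (ℝ ∙ e)ᗮ × ℝ =>
      fderiv ℝ f (shearMap e g p) ((i : E) + fderiv ℝ g p.1 i • e))
      ((volume : Measure (ℝ ∙ e)ᗮ).prod (volume.restrict (Iio 0))) := by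
    have := (hint i).add hint1
    refine this.congr (Eventually.of_forall fun p => ?_)
    simp
  have hintN : Integrable (fun p : (ℝ ∙ e)ᗮ × ℝ =>
      ⟪u, graphNormal e g p.1⟫ * fderiv ℝ f (shearMap e g p) e)
      ((volume : Measure (ℝ ∙ e)ᗮ).prod (volume.restrict (Iio 0))) := by
    refine (((hint e).const_mul ⟪e, u⟫).sub hint1).congr (Eventually.of_forall fun p => ?_)
    simp only [Pi.sub_apply, inner_graphNormal]
    ring
  -- Write `u` as a vector tangent to the graph plus a multiple of `e`; the multiple is exactly `⟪u,
  -- graphNormal e g y⟫`.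
  have hsplit : ∀ p : (ℝ ∙ e)ᗮ × ℝ, fderiv ℝ f (shearMap e g p) u =
      fderiv ℝ f (shearMap e g p) ((i : E) + fderiv ℝ g p.1 i • e) +
        ⟪u, graphNormal e g p.1⟫ * fderiv ℝ f (shearMap e g p) e := by
    intro p
    rw [inner_graphNormal]
    nth_rewrite 1 [← hu]
    simp only [map_add, map_smul, smul_eq_mul]
    ring
  simp_rw [hsplit]
  rw [integral_add hintT hintN]
  have hT : ∫ p, fderiv ℝ f (shearMap e g p) ((i : E) + fderiv ℝ g p.1 i • e)
      ∂((volume : Measure (ℝ ∙ e)ᗮ).prod (volume.restrict (Iio 0))) = 0 := by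
    -- Integrate over `y` first: at fixed height `z` this is the tangential lemma for `g + z`. The
    -- normal part below uses the opposite order.
    rw [integral_prod_symm _ hintT]
    refine integral_eq_zero_of_ae (Eventually.of_forall fun z => ?_)
    have := integral_fderiv_graphMap_tangent he (hg.add (LipschitzWith.const z)) hf hfc i
    simp only [fderiv_add_const] at this
    exact this
  rw [hT, zero_add, integral_prod _ hintN]
  refine integral_congr_ae (Eventually.of_forall fun y => ?_)
  simp only
  rw [integral_const_mul, integral_Iio_fderiv_shearMap hf hfc he, mul_comm]

end Shear

/-! ### The divergence theorem on a Lipschitz subgraph. -/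

section Divergence

variable {E : Type*} [NormedAddCommGroup E] [InnerProductSpace ℝ E] [FiniteDimensional ℝ E]
  {e : E} {g : (ℝ ∙ e)ᗮ → ℝ}

/-- The divergence of a vector field. -/
noncomputable def divergence (H : E → E) (x : E) : ℝ := LinearMap.trace ℝ E (fderiv ℝ H x)

theorem divergence_eq_sum {ι : Type*} [Fintype ι] (b : OrthonormalBasis ι ℝ E) (H : E → E) (x : E) :
    divergence H x = ∑ i, ⟪b i, fderiv ℝ H x (b i)⟫ :=
  LinearMap.trace_eq_sum_inner _ b

theorem Filter.EventuallyEq.divergence_eq {H H' : E → E} {x : E} (h : H =ᶠ[𝓝 x] H') :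
    divergence H x = divergence H' x := by
  rw [divergence, divergence, h.fderiv_eq]

theorem divergence_smul {φ : E → ℝ} {H : E → E} {x : E} (hφ : DifferentiableAt ℝ φ x)
    (hH : DifferentiableAt ℝ H x) :
    divergence (fun x => φ x • H x) x = φ x * divergence H x + fderiv ℝ φ x (H x) := by
  let b := stdOrthonormalBasis ℝ E
  rw [divergence_eq_sum b, divergence_eq_sum b, fderiv_fun_smul hφ hH]
  have h1 : fderiv ℝ φ x (H x) = ∑ i, ⟪b i, H x⟫ * fderiv ℝ φ x (b i) := by
    conv_lhs => rw [← b.sum_repr' (H x)]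
    simp
  rw [h1, Finset.mul_sum, ← Finset.sum_add_distrib]
  refine Finset.sum_congr rfl fun i _ => ?_
  simp [inner_add_right, inner_smul_right, mul_comm]

theorem divergence_sum {ι : Type*} (s : Finset ι) {H : ι → E → E} {x : E}
    (hH : ∀ i ∈ s, DifferentiableAt ℝ (H i) x) :
    divergence (fun x => ∑ i ∈ s, H i x) x = ∑ i ∈ s, divergence (H i) x := by
  simp only [divergence]
  rw [fderiv_fun_sum hH]
  simp

variable [MeasurableSpace E] [BorelSpace E]

theorem setIntegral_subgraph_divergence_of_hasCompactSupport {K : ℝ≥0} (he : ‖e‖ = 1)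
    (hg : LipschitzWith K g) {H : E → E} (hH : ContDiff ℝ 1 H) (hHc : HasCompactSupport H) :
    ∫ x in subgraph e g, divergence H x = ∫ y, ⟪H (graphMap e g y), graphNormal e g y⟫ := by
  let b := stdOrthonormalBasis ℝ E
  have hb : ∀ i, ContDiff ℝ 1 fun x => ⟪b i, H x⟫ := fun i => contDiff_const.inner ℝ hH
  have hbc : ∀ i, HasCompactSupport fun x => ⟪b i, H x⟫ := fun i =>
    hHc.comp_left (g := fun v => ⟪b i, v⟫) (inner_zero_right _)
  have hd : ∀ i x u, ⟪b i, fderiv ℝ H x u⟫ = fderiv ℝ (fun x => ⟪b i, H x⟫) x u := fun i x u => by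
    rw [fderiv_inner_apply ℝ (by fun_prop) (hH.differentiable one_ne_zero x)]
    simp
  have hR : ∀ y, ⟪H (graphMap e g y), graphNormal e g y⟫ =
      ∑ i, ⟪b i, H (graphMap e g y)⟫ * ⟪b i, graphNormal e g y⟫ := fun y => by
    rw [← b.sum_inner_mul_inner]
    simp_rw [real_inner_comm]
  simp_rw [divergence_eq_sum b, hd, hR]
  rw [integral_finsetSum, integral_finsetSum]
  · exact Finset.sum_congr rfl fun i _ => setIntegral_subgraph_fderiv he hg (hb i) (hbc i) _
  · intro i _
    have h1 : Integrable fun y => ⟪b i, H (graphMap e g y)⟫ := by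
      refine Continuous.integrable_of_hasCompactSupport
        ((hb i).continuous.comp (continuous_graphMap hg.continuous)) ?_
      exact (hbc i).comp_isClosedEmbedding (isClosedEmbedding_graphMap hg.continuous)
    refine h1.mul_bdd (c := 1 + K) ?_ ?_
    · exact (measurable_graphNormal.const_inner).aestronglyMeasurable
    · refine Eventually.of_forall fun y => (norm_inner_le_norm _ _).trans ?_
      rw [b.norm_eq_one, one_mul]
      exact norm_graphNormal_le he hg y
  · intro i _
    refine Integrable.integrableOn (Continuous.integrable_of_hasCompactSupport ?_
      ((hbc i).fderiv_apply ℝ _))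
    exact ((hb i).continuous_fderiv one_ne_zero).clm_apply continuous_const

theorem integral_divergence_of_hasCompactSupport {H : E → E} (hH : ContDiff ℝ 1 H)
    (hHc : HasCompactSupport H) : ∫ x, divergence H x = 0 := by
  let b := stdOrthonormalBasis ℝ E
  have hb : ∀ i, ContDiff ℝ 1 fun x => ⟪b i, H x⟫ := fun i => contDiff_const.inner ℝ hH
  have hbc : ∀ i, HasCompactSupport fun x => ⟪b i, H x⟫ := fun i =>
    hHc.comp_left (g := fun v => ⟪b i, v⟫) (inner_zero_right _)
  have hd : ∀ i x u, ⟪b i, fderiv ℝ H x u⟫ = fderiv ℝ (fun x => ⟪b i, H x⟫) x u := fun i x u => by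
    rw [fderiv_inner_apply ℝ (by fun_prop) (hH.differentiable one_ne_zero x)]
    simp
  simp_rw [divergence_eq_sum b, hd]
  rw [integral_finsetSum]
  · refine Finset.sum_eq_zero fun i _ => ?_
    obtain ⟨C, hC⟩ := (hb i).lipschitzWith_of_hasCompactSupport (hbc i) one_ne_zero
    have h1 := (LipschitzWith.const (1 : ℝ)).integral_lineDeriv_mul_eq (μ := volume) hC (hbc i)
      (-b i)
    have : ∀ x : E, lineDeriv ℝ (fun _ : E => (1 : ℝ)) x (-b i) = 0 := fun x => by
      simp [lineDeriv]
    simp only [this, zero_mul, integral_zero, neg_neg, mul_one] at h1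
    rw [h1]
    refine integral_congr_ae (Eventually.of_forall fun x => ?_)
    exact (((hb i).differentiable one_ne_zero x).lineDeriv_eq_fderiv).symm
  · intro i _
    refine Continuous.integrable_of_hasCompactSupport ?_ ((hbc i).fderiv_apply ℝ _)
    exact ((hb i).continuous_fderiv one_ne_zero).clm_apply continuous_const

/-- The closed lowered subgraph lies inside the open set where `H` is C¹. A cutoff equal to 1 near
its part in `C` and to 0 near the complement of that open set makes `H` globally C¹ without changing
it near the lowered subgraph. -/
theorem setIntegral_subgraph_sub_divergence {K : ℝ≥0} (he : ‖e‖ = 1)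
    (hg : LipschitzWith K g) {H : E → E} {C : Set E} (hC : IsCompact C) (hH0 : ∀ x ∉ C, H x = 0)
    (hH1 : ContDiffOn ℝ 1 H (subgraph e g)) {t : ℝ} (ht : 0 < t) :
    ∫ x in subgraph e (fun y => g y - t), divergence H x =
      ∫ y, ⟪H (graphMap e (fun y => g y - t) y), graphNormal e g y⟫ := by
  have hgt : LipschitzWith K fun y => g y - t := by
    simpa [sub_eq_add_neg] using hg.add (LipschitzWith.const (-t))
  set Ct : Set E := C ∩ {x | ⟪e, x⟫ ≤ g ((ℝ ∙ e)ᗮ.orthogonalProjectionOnto x) - t} with hCt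
  have hU := isOpen_subgraph (e := e) hg.continuous
  have hCtc : IsClosed Ct := hC.isClosed.inter (isClosed_closedSubgraph hgt.continuous)
  have hCtU : Disjoint (subgraph e g)ᶜ Ct := by
    refine disjoint_left.2 fun x hx hx' => hx ?_
    have h1 : ⟪e, x⟫ ≤ g ((ℝ ∙ e)ᗮ.orthogonalProjectionOnto x) - t := hx'.2
    show ⟪e, x⟫ < _
    linarith
  obtain ⟨χ, hχ0, hχ1, -⟩ := exists_contMDiffMap_zero_one_nhds_of_isClosed (n := 1)
    (modelWithCornersSelf ℝ E) hU.isClosed_compl hCtc hCtU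
  have hχ : ContDiff ℝ 1 χ := χ.contMDiff.contDiff
  have hC1 : ContDiff ℝ 1 fun x => χ x • H x := by
    refine contDiff_iff_contDiffAt.2 fun x => ?_
    by_cases hx : x ∈ subgraph e g
    · exact hχ.contDiffAt.smul (hH1.contDiffAt (hU.mem_nhds hx))
    · have h1 : (fun x => χ x • H x) =ᶠ[𝓝 x] fun _ => 0 := by
        filter_upwards [hχ0.filter_mono (nhds_le_nhdsSet hx)] with z hz
        rw [hz, zero_smul]
      exact contDiffAt_const.congr_of_eventuallyEq h1
  have hcs : HasCompactSupport fun x => χ x • H x :=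
    HasCompactSupport.intro hC fun x hx => by rw [hH0 x hx, smul_zero]
  have heq : ∀ x, ⟪e, x⟫ ≤ g ((ℝ ∙ e)ᗮ.orthogonalProjectionOnto x) - t →
      (fun x => χ x • H x) =ᶠ[𝓝 x] H := by
    intro x hx
    by_cases hxC : x ∈ C
    · filter_upwards [hχ1.filter_mono (nhds_le_nhdsSet (show x ∈ Ct from ⟨hxC, hx⟩))] with z hz
      rw [hz, one_smul]
    · filter_upwards [hC.isClosed.isOpen_compl.mem_nhds hxC] with z hz
      rw [hH0 z hz, smul_zero]
  have main := setIntegral_subgraph_divergence_of_hasCompactSupport he hgt hC1 hcs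
  have hN : graphNormal e (fun y => g y - t) = graphNormal e g := by
    ext1 y
    simp only [graphNormal, sub_eq_add_neg, gradient_add_const]
  rw [hN] at main
  rw [← setIntegral_congr_fun (isOpen_subgraph hgt.continuous).measurableSet
    fun x hx => (heq x (le_of_lt hx)).divergence_eq, main]
  refine integral_congr_ae (Eventually.of_forall fun y => ?_)
  have := (heq (graphMap e (fun y => g y - t) y) (by
    rw [orthogonalProjectionOnto_graphMap, graphMap, inner_add_smul_self he])).self_of_nhds
  simp only at this ⊢
  rw [this]

/-- The divergence theorem on the subgraph of a Lipschitz function, for a vector field that vanishes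
outside a compact set and is continuous up to the graph. -/
theorem setIntegral_subgraph_divergence {K : ℝ≥0} (he : ‖e‖ = 1)
    (hg : LipschitzWith K g) {H : E → E} {C : Set E} (hC : IsCompact C) (hH0 : ∀ x ∉ C, H x = 0)
    (hH1 : ContDiffOn ℝ 1 H (subgraph e g))
    (hHc : ContinuousOn H {x | ⟪e, x⟫ ≤ g ((ℝ ∙ e)ᗮ.orthogonalProjectionOnto x)})
    (hint : IntegrableOn (divergence H) (subgraph e g)) :
    Integrable (fun y => ⟪H (graphMap e g y), graphNormal e g y⟫) ∧
    ∫ x in subgraph e g, divergence H x = ∫ y, ⟪H (graphMap e g y), graphNormal e g y⟫ := by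
  set S := {x | ⟪e, x⟫ ≤ g ((ℝ ∙ e)ᗮ.orthogonalProjectionOnto x)} with hS
  have hScl : IsClosed S := isClosed_closedSubgraph hg.continuous
  obtain ⟨M, hM⟩ := (hC.inter_right hScl).exists_bound_of_continuousOn (hHc.mono inter_subset_right)
  have hM0 : ∀ x ∈ S, ‖H x‖ ≤ max M 0 := by
    intro x hx
    by_cases hxC : x ∈ C
    · exact (hM x ⟨hxC, hx⟩).trans (le_max_left _ _)
    · simp [hH0 x hxC]
  -- The shadow of `C` supports every flux integrand at once, so `B` dominates uniformly in `t`.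
  let D : Set (ℝ ∙ e)ᗮ := (ℝ ∙ e)ᗮ.orthogonalProjectionOnto '' C
  have hD : IsCompact D := hC.image (by fun_prop)
  let B : (ℝ ∙ e)ᗮ → ℝ := D.indicator fun _ => max M 0 * (1 + K)
  have hB : Integrable B :=
    (integrable_indicator_iff hD.isClosed.measurableSet).2
      (integrableOn_const hD.measure_lt_top.ne)
  have hmemS : ∀ t : ℝ, 0 ≤ t → ∀ y, graphMap e (fun y => g y - t) y ∈ S := by
    intro t ht y
    simp only [hS, mem_ofPred_eq, orthogonalProjectionOnto_graphMap]
    rw [graphMap, inner_add_smul_self he]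
    linarith
  have hbd : ∀ t : ℝ, 0 ≤ t → ∀ y,
      ‖⟪H (graphMap e (fun y => g y - t) y), graphNormal e g y⟫‖ ≤ B y := by
    intro t ht y
    by_cases hy : y ∈ D
    · simp only [B, indicator_of_mem hy]
      refine (norm_inner_le_norm _ _).trans ?_
      exact mul_le_mul (hM0 _ (hmemS t ht y)) (norm_graphNormal_le he hg y) (norm_nonneg _)
        (le_max_right _ _)
    · have : graphMap e (fun y => g y - t) y ∉ C := fun h =>
        hy ⟨_, h, orthogonalProjectionOnto_graphMap y⟩
      simp [B, indicator_of_notMem hy, hH0 _ this]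
  have hmeas : ∀ t : ℝ, 0 ≤ t → AEStronglyMeasurable
      (fun y => ⟪H (graphMap e (fun y => g y - t) y), graphNormal e g y⟫) := by
    intro t ht
    refine AEStronglyMeasurable.inner ?_ measurable_graphNormal.aestronglyMeasurable
    refine Continuous.aestronglyMeasurable ?_
    exact hHc.comp_continuous (continuous_graphMap (hg.continuous.sub continuous_const))
      (hmemS t ht)
  have hmeas0 := hmeas 0 le_rfl
  have hbd0 := hbd 0 le_rfl
  simp only [sub_zero] at hmeas0 hbd0
  refine ⟨hB.mono' hmeas0 (Eventually.of_forall hbd0), ?_⟩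
  let τ : ℕ → ℝ := fun k => 1 / ((k : ℝ) + 1)
  have hτ : ∀ k, 0 < τ k := fun k => Nat.one_div_pos_of_nat
  have hτlim : Tendsto τ atTop (𝓝 0) := tendsto_one_div_add_atTop_nhds_zero_nat
  have hU : ⋃ k, subgraph e (fun y => g y - τ k) = subgraph e g := by
    ext x
    simp only [mem_iUnion, subgraph, mem_ofPred_eq]
    constructor
    · rintro ⟨k, hk⟩
      linarith [hτ k]
    · intro hx
      obtain ⟨k, hk⟩ := (hτlim.eventually (gt_mem_nhds (sub_pos.2 hx))).exists
      exact ⟨k, by linarith⟩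
  -- The volume side needs only integrability of the divergence: the lowered subgraphs increase to
  -- the full one.
  have hL : Tendsto (fun k => ∫ x in subgraph e (fun y => g y - τ k), divergence H x) atTop
      (𝓝 (∫ x in subgraph e g, divergence H x)) := by
    have := tendsto_setIntegral_of_monotone (μ := volume) (f := divergence H)
      (s := fun k => subgraph e (fun y => g y - τ k))
      (fun k => (isOpen_subgraph (hg.continuous.sub continuous_const)).measurableSet) ?_ ?_
    · rwa [hU] at this
    · intro k l hkl x hx
      have h1 : τ l ≤ τ k := Nat.one_div_le_one_div hkl
      have h2 : ⟪e, x⟫ < g ((ℝ ∙ e)ᗮ.orthogonalProjectionOnto x) - τ k := hx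
      show ⟪e, x⟫ < _
      linarith
    · rwa [hU]
  have hR : Tendsto (fun k => ∫ y, ⟪H (graphMap e (fun y => g y - τ k) y), graphNormal e g y⟫) atTop
      (𝓝 (∫ y, ⟪H (graphMap e g y), graphNormal e g y⟫)) := by
    refine tendsto_integral_of_dominated_convergence B (fun k => hmeas _ (hτ k).le) hB
      (fun k => Eventually.of_forall (hbd _ (hτ k).le)) (Eventually.of_forall fun y => ?_)
    refine Tendsto.inner ?_ tendsto_const_nhds
    have h0 : graphMap e g y ∈ S := by simpa using hmemS 0 le_rfl y
    refine (hHc _ h0).tendsto.comp (tendsto_nhdsWithin_iff.2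
      ⟨?_, Eventually.of_forall fun k => hmemS _ (hτ k).le y⟩)
    have : Tendsto (fun k => (y : E) + (g y - τ k) • e) atTop (𝓝 ((y : E) + (g y - 0) • e)) :=
      tendsto_const_nhds.add ((tendsto_const_nhds.sub hτlim).smul_const e)
    simpa [graphMap] using this
  refine tendsto_nhds_unique hL (hR.congr fun k => ?_)
  exact (setIntegral_subgraph_sub_divergence he hg hC hH0 hH1 (hτ k)).symm

end Divergence

/-! ### Topology of subgraphs. -/

section Subgraph

variable {E : Type*} [NormedAddCommGroup E] [InnerProductSpace ℝ E] [FiniteDimensional ℝ E]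
  {e : E} {g : (ℝ ∙ e)ᗮ → ℝ}

theorem closure_subgraph (he : ‖e‖ = 1) (hg : Continuous g) :
    closure (subgraph e g) = {x | ⟪e, x⟫ ≤ g ((ℝ ∙ e)ᗮ.orthogonalProjectionOnto x)} := by
  have h0 : subgraph e g ⊆ {x | ⟪e, x⟫ ≤ g ((ℝ ∙ e)ᗮ.orthogonalProjectionOnto x)} := by
    intro x hx
    simp only [subgraph, mem_ofPred_eq] at hx ⊢
    exact hx.le
  refine subset_antisymm (closure_minimal h0 (isClosed_closedSubgraph hg)) fun x hx => ?_
  have h1 : Tendsto (fun t : ℝ => x - t • e) (𝓝[>] 0) (𝓝 x) := by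
    have : Tendsto (fun t : ℝ => x - t • e) (𝓝 0) (𝓝 (x - (0 : ℝ) • e)) :=
      (Continuous.tendsto (by fun_prop) _)
    simpa using this.mono_left nhdsWithin_le_nhds
  refine mem_closure_of_tendsto h1 (eventually_nhdsWithin_of_forall fun t ht => ?_)
  have h2 : (ℝ ∙ e)ᗮ.orthogonalProjectionOnto (x - t • e) =
      (ℝ ∙ e)ᗮ.orthogonalProjectionOnto x := by simp
  have h3 : ⟪e, x - t • e⟫ = ⟪e, x⟫ - t := by
    rw [inner_sub_right, inner_smul_right, real_inner_self_eq_norm_sq, he]; ring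
  have ht' : 0 < t := ht
  have hx' : ⟪e, x⟫ ≤ g ((ℝ ∙ e)ᗮ.orthogonalProjectionOnto x) := hx
  simp only [subgraph, mem_ofPred_eq, h2, h3]
  linarith

theorem frontier_subgraph (he : ‖e‖ = 1) (hg : Continuous g) :
    frontier (subgraph e g) = range (graphMap e g) := by
  rw [(isOpen_subgraph hg).frontier_eq, closure_subgraph he hg, range_graphMap he]
  ext x
  simp only [subgraph, Set.mem_sdiff, mem_ofPred_eq, not_lt]
  exact ⟨fun h => le_antisymm h.1 h.2, fun h => ⟨h.le, h.ge⟩⟩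

theorem frontier_inter_eq_range_inter {Ω B : Set E} (he : ‖e‖ = 1) (hg : Continuous g)
    (hB : IsOpen B) (h : ∀ x ∈ B, x ∈ Ω ↔ x ∈ subgraph e g) :
    frontier Ω ∩ B = range (graphMap e g) ∩ B := by
  have h1 : Ω ∩ B = subgraph e g ∩ B := by
    ext x; exact and_congr_left fun hx => h x hx
  rw [← frontier_inter_open_inter hB, h1, frontier_inter_open_inter hB, frontier_subgraph he hg]

end Subgraph

/-! ### Outward normals and flux through a graph. -/

section Normal

variable {ℓ : ℕ} {Ω Ω' : Set (EuclideanSpace ℝ (Fin ℓ))} {s ν ν' : EuclideanSpace ℝ (Fin ℓ)}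

theorem IsOutwardUnitNormal.congr (h : IsOutwardUnitNormal Ω s ν)
    (hΩ : ∀ᶠ x in 𝓝 s, x ∈ Ω' ↔ x ∈ Ω) : IsOutwardUnitNormal Ω' s ν := by
  refine ⟨h.1, fun ε hε => ?_⟩
  filter_upwards [h.2 ε hε, hΩ] with x hx hx'
  rwa [hx']

/-- A small step from `s` along `ν' - ν` enters `Ω` according to `ν` and leaves it according to
`ν'`. -/
theorem IsOutwardUnitNormal.unique (h : IsOutwardUnitNormal Ω s ν)
    (h' : IsOutwardUnitNormal Ω s ν') : ν = ν' := by
  by_contra hne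
  have hc : ⟪ν, ν'⟫ < 1 := (inner_lt_one_iff_real_of_norm_eq_one h.1 h'.1).2 hne
  have hd : 0 < ‖ν' - ν‖ := norm_pos_iff.2 (sub_ne_zero.2 (Ne.symm hne))
  -- Half the largest admissible value, so that both cone conditions hold strictly.
  set ε := (1 - ⟪ν, ν'⟫) / (2 * ‖ν' - ν‖) with hε
  have hεpos : 0 < ε := div_pos (by linarith) (by positivity)
  have hεd : ε * ‖ν' - ν‖ < 1 - ⟪ν, ν'⟫ := by
    have : ε * ‖ν' - ν‖ = (1 - ⟪ν, ν'⟫) / 2 := by rw [hε]; field_simp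
    linarith
  have hlim : Tendsto (fun t : ℝ => s + t • (ν' - ν)) (𝓝[>] 0) (𝓝 s) := by
    have : Tendsto (fun t : ℝ => s + t • (ν' - ν)) (𝓝 0) (𝓝 (s + (0 : ℝ) • (ν' - ν))) :=
      (Continuous.tendsto (by fun_prop) _)
    simpa using this.mono_left nhdsWithin_le_nhds
  obtain ⟨t, ⟨⟨h1, h2⟩, ht⟩⟩ := ((hlim.eventually ((h.2 ε hεpos).and (h'.2 ε hεpos))).and
    self_mem_nhdsWithin).exists
  have ht' : 0 < t := ht
  have e1 : ⟪ν, s + t • (ν' - ν) - s⟫ = -(t * (1 - ⟪ν, ν'⟫)) := by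
    rw [add_sub_cancel_left, inner_smul_right, inner_sub_right, real_inner_self_eq_norm_sq, h.1]
    ring
  have e2 : ⟪ν', s + t • (ν' - ν) - s⟫ = t * (1 - ⟪ν, ν'⟫) := by
    rw [add_sub_cancel_left, inner_smul_right, inner_sub_right, real_inner_self_eq_norm_sq, h'.1,
      real_inner_comm]
    ring
  have e3 : ‖s + t • (ν' - ν) - s‖ = t * ‖ν' - ν‖ := by
    rw [add_sub_cancel_left, norm_smul, Real.norm_of_nonneg ht'.le]
  have e4 : ε * (t * ‖ν' - ν‖) < t * (1 - ⟪ν, ν'⟫) := by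
    calc ε * (t * ‖ν' - ν‖) = t * (ε * ‖ν' - ν‖) := by ring
      _ < _ := by gcongr
  rw [e1, e3] at h1
  rw [e2, e3] at h2
  exact h2.2 e4 (h1.1 (by linarith))

theorem IsOutwardUnitNormal.outwardNormal_eq (h : IsOutwardUnitNormal Ω s ν) :
    outwardNormal Ω s = ν := by
  have hex : ∃ ν, IsOutwardUnitNormal Ω s ν := ⟨ν, h⟩
  rw [outwardNormal, dif_pos hex]
  exact hex.choose_spec.unique h

variable {e : EuclideanSpace ℝ (Fin ℓ)} {g : (ℝ ∙ e)ᗮ → ℝ}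

/-- The signed height of `x` above the graph equals `⟪graphNormal e g y, x - s⟫` up to `o(‖x - s‖)`,
where `s` is the base point on the graph. Normalizing is harmless because the normal has length at
least 1. -/
theorem isOutwardUnitNormal_subgraph (he : ‖e‖ = 1) {y : (ℝ ∙ e)ᗮ} (hy : DifferentiableAt ℝ g y) :
    IsOutwardUnitNormal (subgraph e g) (graphMap e g y)
      (‖graphNormal e g y‖⁻¹ • graphNormal e g y) := by
  have hN := one_le_norm_graphNormal (g := g) he y
  have hN0 : 0 < ‖graphNormal e g y‖ := by linarith
  refine ⟨by rw [norm_smul, norm_inv, norm_norm, inv_mul_cancel₀ hN0.ne'], fun ε hε => ?_⟩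
  have hπ : Tendsto (ℝ ∙ e)ᗮ.orthogonalProjectionOnto (𝓝 (graphMap e g y)) (𝓝 y) := by
    have := ((ℝ ∙ e)ᗮ.orthogonalProjectionOnto.continuous).tendsto (graphMap e g y)
    rwa [orthogonalProjectionOnto_graphMap] at this
  filter_upwards [hπ.eventually (hy.hasFDerivAt.isLittleO.def hε)] with x hx
  set h := x - graphMap e g y with hh
  have hπh : (ℝ ∙ e)ᗮ.orthogonalProjectionOnto h =
      (ℝ ∙ e)ᗮ.orthogonalProjectionOnto x - y := by
    rw [hh, map_sub, orthogonalProjectionOnto_graphMap]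
  have hle : ‖(ℝ ∙ e)ᗮ.orthogonalProjectionOnto h‖ ≤ ‖h‖ :=
    Submodule.norm_orthogonalProjectionOnto_apply_le _ _
  rw [← hπh] at hx
  have hinner : ⟪graphNormal e g y, h⟫ = ⟪e, x⟫ - g y -
      fderiv ℝ g y ((ℝ ∙ e)ᗮ.orthogonalProjectionOnto h) := by
    rw [real_inner_comm, inner_graphNormal, hh, inner_sub_right, graphMap,
      inner_add_smul_self he]
  have hR : ‖g ((ℝ ∙ e)ᗮ.orthogonalProjectionOnto x) - g y -
      fderiv ℝ g y ((ℝ ∙ e)ᗮ.orthogonalProjectionOnto h)‖ ≤ ε * ‖h‖ := hx.trans (by gcongr)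
  rw [Real.norm_eq_abs, abs_le] at hR
  have hscale : ⟪‖graphNormal e g y‖⁻¹ • graphNormal e g y, h⟫ * ‖graphNormal e g y‖ =
      ⟪graphNormal e g y, h⟫ := by
    rw [real_inner_smul_left]; field_simp
  have hεh : ε * ‖h‖ ≤ ε * ‖h‖ * ‖graphNormal e g y‖ :=
    le_mul_of_one_le_right (by positivity) hN
  constructor
  · intro h1
    have h2 := mul_lt_mul_of_pos_right h1 hN0
    rw [hscale] at h2
    simp only [subgraph, mem_ofPred_eq]
    linarith
  · intro h1
    have h2 := mul_lt_mul_of_pos_right h1 hN0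
    rw [hscale] at h2
    simp only [subgraph, mem_ofPred_eq, not_lt]
    linarith

theorem finrank_orthogonal_span_unit (hℓ : 1 ≤ ℓ) (he : ‖e‖ = 1) :
    Module.finrank ℝ (ℝ ∙ e)ᗮ = ℓ - 1 := by
  have h1 := Submodule.finrank_add_finrank_orthogonal (ℝ ∙ e)
  have h0 : e ≠ 0 := fun h => by simp [h] at he
  rw [finrank_span_singleton h0, finrank_euclideanSpace_fin] at h1
  omega

variable {B : Set (EuclideanSpace ℝ (Fin ℓ))} {K : ℝ≥0}

theorem ae_isOutwardUnitNormal_of_subgraph (hℓ : 1 ≤ ℓ) (he : ‖e‖ = 1) (hg : LipschitzWith K g)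
    (hB : IsOpen B) (h : ∀ x ∈ B, x ∈ Ω ↔ x ∈ subgraph e g) :
    ∀ᵐ s ∂(μHE[ℓ - 1].restrict (range (graphMap e g))), s ∈ B →
      IsOutwardUnitNormal Ω s (‖graphNormal e g ((ℝ ∙ e)ᗮ.orthogonalProjectionOnto s)‖⁻¹ •
        graphNormal e g ((ℝ ∙ e)ᗮ.orthogonalProjectionOnto s)) := by
  rw [← finrank_orthogonal_span_unit hℓ he, euclideanHausdorffMeasure_restrict_range_graphMap he hg,
    (measurableEmbedding_graphMap hg.continuous).ae_map_iff]
  refine (withDensity_absolutelyContinuous _ _).ae_le ?_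
  filter_upwards [hg.ae_differentiableAt] with y hy hyB
  rw [orthogonalProjectionOnto_graphMap]
  exact (isOutwardUnitNormal_subgraph he hy).congr (mem_of_superset (hB.mem_nhds hyB) h)

/-- Being null is a local property, so a single chart suffices. -/
theorem ae_isOutwardUnitNormal (hℓ : 1 ≤ ℓ) (hΩ : IsBoundedLipschitzDomain Ω) :
    ∀ᵐ s ∂(surfaceMeasure Ω), IsOutwardUnitNormal Ω s (outwardNormal Ω s) := by
  rw [surfaceMeasure, ae_restrict_iff' isClosed_frontier.measurableSet, ae_iff]
  refine measure_null_of_locally_null _ fun p hp => ?_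
  simp only [Classical.not_imp, mem_ofPred_eq] at hp
  obtain ⟨e, he, K, g, hg, hev⟩ := hΩ.locally_subgraph p hp.1
  obtain ⟨r, hr, hball⟩ := Metric.eventually_nhds_iff_ball.1 hev
  refine ⟨_, inter_mem_nhdsWithin _ (Metric.ball_mem_nhds p hr), ?_⟩
  have h1 := ae_isOutwardUnitNormal_of_subgraph hℓ he hg Metric.isOpen_ball hball
  rw [ae_restrict_iff' (measurableEmbedding_graphMap hg.continuous).measurableSet_range,
    ae_iff] at h1
  refine measure_mono_null ?_ h1
  rintro s ⟨hs, hsB⟩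
  simp only [Classical.not_imp, mem_ofPred_eq] at hs ⊢
  have hs' : s ∈ range (graphMap e g) ∩ Metric.ball p r := by
    rw [← frontier_inter_eq_range_inter he hg.continuous Metric.isOpen_ball hball]
    exact ⟨hs.1, hsB⟩
  refine ⟨hs'.1, hsB, fun h => hs.2 ?_⟩
  rwa [h.outwardNormal_eq]

/-- The flux of a vector field through a piece of boundary which is a Lipschitz graph. -/
theorem surface_flux_of_subgraph (hℓ : 1 ≤ ℓ) (he : ‖e‖ = 1)
    (hg : LipschitzWith K g) (hB : IsOpen B) (h : ∀ x ∈ B, x ∈ Ω ↔ x ∈ subgraph e g)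
    {F : EuclideanSpace ℝ (Fin ℓ) → EuclideanSpace ℝ (Fin ℓ)} (hF : ∀ s ∉ B, F s = 0)
    (hint : Integrable fun y => ⟪F (graphMap e g y), graphNormal e g y⟫) :
    Integrable (fun s => ⟪F s, outwardNormal Ω s⟫) (surfaceMeasure Ω) ∧
    ∫ s, ⟪F s, outwardNormal Ω s⟫ ∂(surfaceMeasure Ω) =
      ∫ y, ⟪F (graphMap e g y), graphNormal e g y⟫ := by
  have hemb := measurableEmbedding_graphMap (e := e) hg.continuous
  have hdens : Measurable fun y => ENNReal.ofReal ‖graphNormal e g y‖ :=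
    measurable_graphNormal.norm.ennreal_ofReal
  -- The area element cancels the normalization of the normal.
  have hpt : ∀ y, (ENNReal.ofReal ‖graphNormal e g y‖).toReal •
      ⟪F (graphMap e g y), ‖graphNormal e g y‖⁻¹ • graphNormal e g y⟫ =
      ⟪F (graphMap e g y), graphNormal e g y⟫ := fun y => by
    have : ‖graphNormal e g y‖ ≠ 0 := by linarith [one_le_norm_graphNormal (g := g) he y]
    rw [ENNReal.toReal_ofReal (norm_nonneg _), real_inner_smul_right, smul_eq_mul,
      mul_inv_cancel_left₀ this]
  have hint' := hint
  simp_rw [← hpt] at hint' ⊢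
  rw [← integrable_withDensity_iff_integrable_smul' hdens
    (Eventually.of_forall fun y => ENNReal.ofReal_lt_top)] at hint'
  rw [← integral_withDensity_eq_integral_toReal_smul hdens
    (Eventually.of_forall fun y => ENNReal.ofReal_lt_top)]
  -- The flux density as an explicit function of the point, so that it can be pushed forward; it
  -- agrees almost everywhere on the graph with the one built on `outwardNormal`.
  let f : EuclideanSpace ℝ (Fin ℓ) → ℝ := fun s =>
    ⟪F s, ‖graphNormal e g ((ℝ ∙ e)ᗮ.orthogonalProjectionOnto s)‖⁻¹ •
      graphNormal e g ((ℝ ∙ e)ᗮ.orthogonalProjectionOnto s)⟫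
  have hf : ∀ y, ⟪F (graphMap e g y), ‖graphNormal e g y‖⁻¹ • graphNormal e g y⟫ =
      f (graphMap e g y) := fun y => by
    simp only [f, orthogonalProjectionOnto_graphMap]
  simp_rw [hf] at hint' ⊢
  have hmap := euclideanHausdorffMeasure_restrict_range_graphMap he hg
  rw [finrank_orthogonal_span_unit hℓ he] at hmap
  have hint2 := hemb.integrable_map_iff.2 (show Integrable (f ∘ graphMap e g) _ from hint')
  rw [← hemb.integral_map, ← hmap]
  rw [← hmap] at hint2
  have hae : (fun s => ⟪F s, outwardNormal Ω s⟫) =ᵐ[μHE[ℓ - 1].restrict (range (graphMap e g))]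
      f := by
    filter_upwards [ae_isOutwardUnitNormal_of_subgraph hℓ he hg hB h] with s hs
    by_cases hsB : s ∈ B
    · simp only [f, (hs hsB).outwardNormal_eq]
    · simp [f, hF s hsB]
  have hint3 := (integrable_congr hae).2 hint2
  have hfr := frontier_inter_eq_range_inter he hg.continuous hB h
  have hzero : ∀ s ∉ B, ⟪F s, outwardNormal Ω s⟫ = 0 := fun s hs => by
    rw [hF s hs, inner_zero_left]
  have hfm : MeasurableSet (frontier Ω) := isClosed_frontier.measurableSet
  constructor
  · refine IntegrableOn.of_forall_sdiff_eq_zero (s := frontier Ω ∩ B) ?_ hfm fun s hs =>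
      hzero s fun hsB => hs.2 ⟨hs.1, hsB⟩
    rw [hfr]
    exact IntegrableOn.mono_set hint3 inter_subset_left
  · rw [← integral_congr_ae hae, surfaceMeasure,
      setIntegral_eq_of_subset_of_forall_sdiff_eq_zero hfm (inter_subset_left (t := B)) fun s hs =>
        hzero s fun hsB => hs.2 ⟨hs.1, hsB⟩, hfr,
      setIntegral_eq_of_subset_of_forall_sdiff_eq_zero hemb.measurableSet_range
        (inter_subset_left (t := B)) fun s hs => hzero s fun hsB => hs.2 ⟨hs.1, hsB⟩]

end Normal

/-! ### Cutoffs and partitions of unity. -/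

section Localization

variable {E : Type*} [NormedAddCommGroup E] [InnerProductSpace ℝ E] [FiniteDimensional ℝ E]
  [MeasurableSpace E] [BorelSpace E] {Ω : Set E} {φ : E → ℝ} {H : E → E}

theorem divergence_eq_zero_of_notMem_tsupport {x : E} (hx : x ∉ tsupport φ) :
    divergence (fun x => φ x • H x) x = 0 := by
  have h1 : (fun x => φ x • H x) =ᶠ[𝓝 x] fun _ => 0 := by
    filter_upwards [(isClosed_tsupport φ).isOpen_compl.mem_nhds hx] with z hz
    rw [image_eq_zero_of_notMem_tsupport hz, zero_smul]
  rw [h1.divergence_eq, divergence]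
  simp

/-- The extra term of the product rule, `∇φ · H`, is continuous on the compact closure. -/
theorem integrableOn_divergence_smul (hΩ : IsOpen Ω) (hb : Bornology.IsBounded Ω)
    (hφ : ContDiff ℝ 1 φ) (hH : ContinuousOn H (closure Ω)) (hH' : ContDiffOn ℝ 1 H Ω)
    (hint : IntegrableOn (divergence H) Ω) :
    IntegrableOn (divergence fun x => φ x • H x) Ω := by
  have hK : IsCompact (closure Ω) := hb.isCompact_closure
  have h1 : IntegrableOn (fun x => φ x * divergence H x) Ω :=
    hint.continuousOn_mul_of_subset hφ.continuous.continuousOn hK hΩ.measurableSet subset_closure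
  have h2 : IntegrableOn (fun x => fderiv ℝ φ x (H x)) Ω := by
    refine IntegrableOn.mono_set (ContinuousOn.integrableOn_compact hK ?_) subset_closure
    exact (hφ.continuous_fderiv one_ne_zero).continuousOn.clm_apply hH
  refine (h1.add h2).congr_fun (fun x hx => ?_) hΩ.measurableSet
  exact (divergence_smul (hφ.differentiable one_ne_zero x)
    ((hH'.contDiffAt (hΩ.mem_nhds hx)).differentiableAt one_ne_zero)).symm

theorem contDiff_smul_of_tsupport_subset (hΩ : IsOpen Ω) (hφ : ContDiff ℝ 1 φ)
    (hH' : ContDiffOn ℝ 1 H Ω) (hsupp : tsupport φ ⊆ Ω) : ContDiff ℝ 1 fun x => φ x • H x := by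
  refine contDiff_iff_contDiffAt.2 fun x => ?_
  by_cases hx : x ∈ Ω
  · exact hφ.contDiffAt.smul (hH'.contDiffAt (hΩ.mem_nhds hx))
  · have h1 : (fun x => φ x • H x) =ᶠ[𝓝 x] fun _ => 0 := by
      filter_upwards [(isClosed_tsupport φ).isOpen_compl.mem_nhds fun h => hx (hsupp h)] with z hz
      rw [image_eq_zero_of_notMem_tsupport hz, zero_smul]
    exact contDiffAt_const.congr_of_eventuallyEq h1

theorem setIntegral_divergence_smul_of_tsupport_subset (hΩ : IsOpen Ω)
    (hb : Bornology.IsBounded Ω) (hφ : ContDiff ℝ 1 φ) (hH' : ContDiffOn ℝ 1 H Ω)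
    (hsupp : tsupport φ ⊆ Ω) : ∫ x in Ω, divergence (fun x => φ x • H x) x = 0 := by
  have hφc : HasCompactSupport φ :=
    Metric.isCompact_of_isClosed_isBounded (isClosed_tsupport φ) (hb.subset hsupp)
  rw [setIntegral_eq_integral_of_forall_compl_eq_zero fun x hx =>
    divergence_eq_zero_of_notMem_tsupport fun h => hx (hsupp h)]
  exact integral_divergence_of_hasCompactSupport
    (contDiff_smul_of_tsupport_subset hΩ hφ hH' hsupp) hφc.smul_right

theorem setIntegral_divergence_smul_of_subgraph {e : E} {g : (ℝ ∙ e)ᗮ → ℝ} {K : ℝ≥0} {B : Set E}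
    (hΩ : IsOpen Ω) (hb : Bornology.IsBounded Ω) (he : ‖e‖ = 1) (hg : LipschitzWith K g)
    (hB : IsOpen B) (hBb : Bornology.IsBounded B) (h : ∀ x ∈ B, x ∈ Ω ↔ x ∈ subgraph e g)
    (hφ : ContDiff ℝ 1 φ) (hsupp : tsupport φ ⊆ B)
    (hH : ContinuousOn H (closure Ω)) (hH' : ContDiffOn ℝ 1 H Ω)
    (hint : IntegrableOn (divergence H) Ω) :
    Integrable (fun y => ⟪φ (graphMap e g y) • H (graphMap e g y), graphNormal e g y⟫) ∧
    ∫ x in Ω, divergence (fun x => φ x • H x) x =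
      ∫ y, ⟪φ (graphMap e g y) • H (graphMap e g y), graphNormal e g y⟫ := by
  have hφc : IsCompact (tsupport φ) :=
    Metric.isCompact_of_isClosed_isBounded (isClosed_tsupport φ) (hBb.subset hsupp)
  have hF0 : ∀ x ∉ tsupport φ, φ x • H x = 0 := fun x hx => by
    rw [image_eq_zero_of_notMem_tsupport hx, zero_smul]
  have hFnear : ∀ x ∉ B, (fun x => φ x • H x) =ᶠ[𝓝 x] fun _ => 0 := fun x hx => by
    filter_upwards [(isClosed_tsupport φ).isOpen_compl.mem_nhds fun h => hx (hsupp h)] with z hz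
    exact hF0 z hz
  have hdiv0 : ∀ x ∉ B, divergence (fun x => φ x • H x) x = 0 := fun x hx =>
    divergence_eq_zero_of_notMem_tsupport fun h => hx (hsupp h)
  have hU := isOpen_subgraph (e := e) hg.continuous
  have hinter : subgraph e g ∩ B = Ω ∩ B := by
    ext x; exact and_congr_left fun hx => (h x hx).symm
  have hF1 : ContDiffOn ℝ 1 (fun x => φ x • H x) (subgraph e g) := by
    intro x hx
    refine ContDiffAt.contDiffWithinAt ?_
    by_cases hxB : x ∈ B
    · exact hφ.contDiffAt.smul (hH'.contDiffAt (hΩ.mem_nhds ((h x hxB).2 hx)))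
    · exact contDiffAt_const.congr_of_eventuallyEq (hFnear x hxB)
  have hFc : ContinuousOn (fun x => φ x • H x) (closure (subgraph e g)) := by
    intro x hx
    by_cases hxB : x ∈ B
    -- Continuity of `H` is known only on `closure Ω`. Since `B` is open, points of the closed
    -- subgraph in `B` are limits of points of `subgraph e g ∩ B = Ω ∩ B`.
    · have hsub : closure (subgraph e g) ∩ B ⊆ closure Ω := by
        refine (hB.closure_inter).trans ?_
        rw [hinter]
        exact closure_mono inter_subset_left
      have hmem : closure Ω ∈ 𝓝[closure (subgraph e g)] x :=
        mem_of_superset (inter_mem_nhdsWithin _ (hB.mem_nhds hxB)) hsub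
      exact hφ.continuous.continuousWithinAt.smul
        ((hH x (hsub ⟨hx, hxB⟩)).mono_of_mem_nhdsWithin hmem)
    · exact (continuousAt_const.congr (hFnear x hxB).symm).continuousWithinAt
  rw [closure_subgraph he hg.continuous] at hFc
  have hintΩ := integrableOn_divergence_smul hΩ hb hφ hH hH' hint
  have hintU : IntegrableOn (divergence fun x => φ x • H x) (subgraph e g) := by
    refine IntegrableOn.of_forall_sdiff_eq_zero (s := subgraph e g ∩ B) ?_ hU.measurableSet
      fun x hx => hdiv0 x fun hxB => hx.2 ⟨hx.1, hxB⟩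
    rw [hinter]
    exact hintΩ.mono_set inter_subset_left
  have main := setIntegral_subgraph_divergence he hg hφc hF0 hF1 hFc hintU
  refine ⟨main.1, main.2 ▸ ?_⟩
  rw [setIntegral_eq_of_subset_of_forall_sdiff_eq_zero hΩ.measurableSet
      (inter_subset_left (t := B)) fun x hx => hdiv0 x fun hxB => hx.2 ⟨hx.1, hxB⟩,
    ← hinter, setIntegral_eq_of_subset_of_forall_sdiff_eq_zero hU.measurableSet
      (inter_subset_left (t := B)) fun x hx => hdiv0 x fun hxB => hx.2 ⟨hx.1, hxB⟩]

theorem exists_finite_partition_of_unity {K : Set E} (hK : IsCompact K) {W : E → Set E}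
    (hW : ∀ x ∈ K, IsOpen (W x) ∧ x ∈ W x) :
    ∃ (t : Finset K) (φ : t → E → ℝ), (∀ i, ContDiff ℝ 1 (φ i)) ∧
      (∀ i, tsupport (φ i) ⊆ W i.1) ∧ ∀ x ∈ K, ∑ i, φ i x = 1 := by
  obtain ⟨t, ht⟩ := hK.elim_finite_subcover (fun x : K => W x) (fun x => (hW x x.2).1)
    fun x hx => mem_iUnion.2 ⟨⟨x, hx⟩, (hW x hx).2⟩
  obtain ⟨f, hf⟩ := SmoothPartitionOfUnity.exists_isSubordinate (modelWithCornersSelf ℝ E)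
    hK.isClosed (fun i : t => W i.1) (fun i => (hW _ i.1.2).1) (by
      intro x hx
      obtain ⟨i, hi, hxi⟩ := mem_iUnion₂.1 (ht hx)
      exact mem_iUnion.2 ⟨⟨i, hi⟩, hxi⟩)
  refine ⟨t, fun i => f i, fun i => ?_, hf, fun x hx => ?_⟩
  · exact ((f i).contMDiff.contDiff).of_le (by exact_mod_cast le_top)
  · rw [← finsum_eq_sum_of_fintype]
    exact f.sum_eq_one hx

end Localization

/-! ### The divergence theorem on a bounded Lipschitz domain. -/

section DivergenceTheorem

variable {ℓ : ℕ} {Ω : Set (EuclideanSpace ℝ (Fin ℓ))}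
  {H : EuclideanSpace ℝ (Fin ℓ) → EuclideanSpace ℝ (Fin ℓ)}

/-- For `p` in `Ω` take `W = Ω`, where both sides vanish; for a boundary point take a ball on which
`Ω` is a subgraph. `W` precedes `φ`, so a partition of unity can be chosen afterwards. -/
theorem exists_nhds_divergence_smul (hℓ : 1 ≤ ℓ) (hΩ : IsBoundedLipschitzDomain Ω)
    (hH : ContinuousOn H (closure Ω)) (hH' : ContDiffOn ℝ 1 H Ω)
    (hint : IntegrableOn (divergence H) Ω) {p : EuclideanSpace ℝ (Fin ℓ)} (hp : p ∈ closure Ω) :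
    ∃ W : Set (EuclideanSpace ℝ (Fin ℓ)), IsOpen W ∧ p ∈ W ∧
      ∀ φ : EuclideanSpace ℝ (Fin ℓ) → ℝ, ContDiff ℝ 1 φ → tsupport φ ⊆ W →
        Integrable (fun s => ⟪φ s • H s, outwardNormal Ω s⟫) (surfaceMeasure Ω) ∧
        ∫ x in Ω, divergence (fun x => φ x • H x) x =
          ∫ s, ⟪φ s • H s, outwardNormal Ω s⟫ ∂(surfaceMeasure Ω) := by
  by_cases hpΩ : p ∈ Ω
  · refine ⟨Ω, hΩ.isOpen, hpΩ, fun φ hφ hsupp => ?_⟩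
    have h0 : (fun s => ⟪φ s • H s, outwardNormal Ω s⟫) =ᵐ[surfaceMeasure Ω] 0 := by
      refine (ae_restrict_iff' isClosed_frontier.measurableSet).2 (Eventually.of_forall fun s hs => ?_)
      have : s ∉ tsupport φ := fun h =>
        (disjoint_left.1 (disjoint_frontier_iff_isOpen.2 hΩ.isOpen) hs) (hsupp h)
      simp [image_eq_zero_of_notMem_tsupport this]
    refine ⟨(integrable_congr h0).2 (integrable_zero _ _ _), ?_⟩
    rw [integral_eq_zero_of_ae h0, setIntegral_divergence_smul_of_tsupport_subset hΩ.isOpen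
      hΩ.isBounded hφ hH' hsupp]
  · have hpf : p ∈ frontier Ω := by
      rw [hΩ.isOpen.frontier_eq]; exact ⟨hp, hpΩ⟩
    obtain ⟨e, he, K, g, hg, hev⟩ := hΩ.locally_subgraph p hpf
    obtain ⟨r, hr, hball⟩ := Metric.eventually_nhds_iff_ball.1 hev
    refine ⟨Metric.ball p r, Metric.isOpen_ball, Metric.mem_ball_self hr, fun φ hφ hsupp => ?_⟩
    have h1 := setIntegral_divergence_smul_of_subgraph hΩ.isOpen hΩ.isBounded he hg
      Metric.isOpen_ball Metric.isBounded_ball hball hφ hsupp hH hH' hint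
    have h2 := surface_flux_of_subgraph hℓ he hg Metric.isOpen_ball hball
      (F := fun s => φ s • H s) (fun s hs => by
        rw [image_eq_zero_of_notMem_tsupport fun h => hs (hsupp h), zero_smul]) h1.1
    exact ⟨h2.1, h1.2.trans h2.2.symm⟩

/-- The divergence theorem on a bounded Lipschitz domain. -/
theorem IsBoundedLipschitzDomain.setIntegral_divergence (hℓ : 1 ≤ ℓ)
    (hΩ : IsBoundedLipschitzDomain Ω)
    (hH : ContinuousOn H (closure Ω)) (hH' : ContDiffOn ℝ 1 H Ω)
    (hint : IntegrableOn (divergence H) Ω) :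
    Integrable (fun s => ⟪H s, outwardNormal Ω s⟫) (surfaceMeasure Ω) ∧
    ∫ x in Ω, divergence H x = ∫ s, ⟪H s, outwardNormal Ω s⟫ ∂(surfaceMeasure Ω) := by
  choose! W hWo hWp hW using fun p => exists_nhds_divergence_smul hℓ hΩ hH hH' hint (p := p)
  obtain ⟨t, φ, hφ, hsupp, hsum⟩ := exists_finite_partition_of_unity
    hΩ.isBounded.isCompact_closure (W := W) fun x hx => ⟨hWo x hx, hWp x hx⟩
  have hi := fun i : t => hW _ i.1.2 (φ i) (hφ i) (hsupp i)
  have hsurf : (fun s => ⟪H s, outwardNormal Ω s⟫) =ᵐ[surfaceMeasure Ω]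
      fun s => ∑ i, ⟪φ i s • H s, outwardNormal Ω s⟫ := by
    refine (ae_restrict_iff' isClosed_frontier.measurableSet).2 (Eventually.of_forall fun s hs => ?_)
    simp only
    rw [← sum_inner, ← Finset.sum_smul, hsum s (frontier_subset_closure hs), one_smul]
  have hdiv : ∀ x ∈ Ω, divergence H x = ∑ i, divergence (fun x => φ i x • H x) x := by
    intro x hx
    rw [← divergence_sum]
    -- The partition sums to 1 only on `closure Ω`; openness of `Ω` gives this near `x`, as
    -- differentiation requires.
    · refine EventuallyEq.divergence_eq ?_
      filter_upwards [hΩ.isOpen.mem_nhds hx] with z hz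
      rw [← Finset.sum_smul, hsum z (subset_closure hz), one_smul]
    · intro i _
      exact ((hφ i).differentiable one_ne_zero x).smul
        ((hH'.contDiffAt (hΩ.isOpen.mem_nhds hx)).differentiableAt one_ne_zero)
  refine ⟨(integrable_congr hsurf).2 (integrable_finsetSum _ fun i _ => (hi i).1), ?_⟩
  rw [integral_congr_ae hsurf, setIntegral_congr_fun hΩ.isOpen.measurableSet hdiv,
    integral_finsetSum _ fun i _ => (hi i).1, integral_finsetSum _ fun i _ =>
      integrableOn_divergence_smul hΩ.isOpen hΩ.isBounded (hφ i) hH hH' hint]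
  exact Finset.sum_congr rfl fun i _ => (hi i).2

end DivergenceTheorem

/-! ### Reduction of Green's identity to the divergence theorem. -/

section Green

variable {ℓ m n : ℕ}

theorem dotProduct_transpose_mulVec {m n : Type*} [Fintype m] [Fintype n] (A : Matrix m n ℝ)
    (v : m → ℝ) (w : n → ℝ) : w ⬝ᵥ (Aᵀ *ᵥ v) = v ⬝ᵥ (A *ᵥ w) := by
  rw [Matrix.mulVec_transpose, dotProduct_comm, Matrix.dotProduct_mulVec]

theorem fderiv_dotProduct_mulVec_apply {E : Type*} [NormedAddCommGroup E] [NormedSpace ℝ E]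
    {m n : Type*} [Fintype m] [Fintype n] (A : Matrix m n ℝ) {v : E → m → ℝ} {w : E → n → ℝ}
    {x : E} (hv : DifferentiableAt ℝ v x) (hw : DifferentiableAt ℝ w x) (u : E) :
    fderiv ℝ (fun x => v x ⬝ᵥ (A *ᵥ w x)) x u =
      fderiv ℝ v x u ⬝ᵥ (A *ᵥ w x) + v x ⬝ᵥ (A *ᵥ fderiv ℝ w x u) := by
  have hv' : ∀ i, HasFDerivAt (fun x => v x i) ((ContinuousLinearMap.proj i).comp (fderiv ℝ v x)) x :=
    fun i => (hasFDerivAt_pi'.1 hv.hasFDerivAt) i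
  have hw' : ∀ i, HasFDerivAt (fun x => w x i) ((ContinuousLinearMap.proj i).comp (fderiv ℝ w x)) x :=
    fun i => (hasFDerivAt_pi'.1 hw.hasFDerivAt) i
  have hA : ∀ i, HasFDerivAt (fun x => (A *ᵥ w x) i)
      (∑ j, A i j • (ContinuousLinearMap.proj j).comp (fderiv ℝ w x)) x := fun i => by
    simp only [Matrix.mulVec, dotProduct]
    exact HasFDerivAt.fun_sum fun j _ => (hw' j).const_mul (A i j)
  have h := HasFDerivAt.fun_sum (u := Finset.univ) fun i _ => (hv' i).mul (hA i)
  have h2 : HasFDerivAt (fun x => v x ⬝ᵥ (A *ᵥ w x)) _ x := h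
  rw [h2.fderiv]
  simp [dotProduct, Matrix.mulVec, Finset.sum_add_distrib, add_comm, mul_comm]

/-- The vector field whose `k`-th component is `vᵀ Aₖ w`. -/
noncomputable def greenField (A : Fin ℓ → Matrix (Fin m) (Fin n) ℝ)
    (v : EuclideanSpace ℝ (Fin ℓ) → Fin m → ℝ) (w : EuclideanSpace ℝ (Fin ℓ) → Fin n → ℝ)
    (x : EuclideanSpace ℝ (Fin ℓ)) : EuclideanSpace ℝ (Fin ℓ) :=
  WithLp.toLp 2 fun k => v x ⬝ᵥ (A k *ᵥ w x)

variable {A : Fin ℓ → Matrix (Fin m) (Fin n) ℝ}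
  {v : EuclideanSpace ℝ (Fin ℓ) → Fin m → ℝ} {w : EuclideanSpace ℝ (Fin ℓ) → Fin n → ℝ}
  {S : Set (EuclideanSpace ℝ (Fin ℓ))}

theorem contDiffOn_greenField (hv : ContDiffOn ℝ 1 v S) (hw : ContDiffOn ℝ 1 w S) :
    ContDiffOn ℝ 1 (greenField A v w) S := by
  refine contDiffOn_euclidean.2 fun k => ?_
  simp only [greenField, dotProduct, Matrix.mulVec]
  exact ContDiffOn.sum fun i _ => (contDiffOn_pi.1 hv i).mul
    (ContDiffOn.sum fun j _ => contDiffOn_const.mul (contDiffOn_pi.1 hw j))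

theorem continuousOn_greenField (hv : ContinuousOn v S) (hw : ContinuousOn w S) :
    ContinuousOn (greenField A v w) S := by
  refine (PiLp.continuous_toLp 2 _).comp_continuousOn (continuousOn_pi.2 fun k => ?_)
  simp only [dotProduct, Matrix.mulVec]
  exact continuousOn_finsetSum _ fun i _ => (continuousOn_pi.1 hv i).mul
    (continuousOn_finsetSum _ fun j _ => continuousOn_const.mul (continuousOn_pi.1 hw j))

theorem divergence_greenField {x : EuclideanSpace ℝ (Fin ℓ)} (hS : S ∈ 𝓝 x)
    (hv : ContDiffOn ℝ 1 v S) (hw : ContDiffOn ℝ 1 w S) :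
    divergence (greenField A v w) x =
      ∑ k, (partialDeriv k v x ⬝ᵥ (A k *ᵥ w x) + v x ⬝ᵥ (A k *ᵥ partialDeriv k w x)) := by
  rw [divergence_eq_sum (EuclideanSpace.basisFun (Fin ℓ) ℝ)]
  refine Finset.sum_congr rfl fun k _ => ?_
  have hd := ((contDiffOn_greenField (A := A) hv hw).contDiffAt hS).differentiableAt one_ne_zero
  have h1 : HasFDerivAt (fun x => greenField A v w x k) _ x :=
    (EuclideanSpace.proj (𝕜 := ℝ) k).hasFDerivAt.comp x hd.hasFDerivAt
  rw [partialDeriv, partialDeriv, ← fderiv_dotProduct_mulVec_apply (A k)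
    ((hv.contDiffAt hS).differentiableAt one_ne_zero)
    ((hw.contDiffAt hS).differentiableAt one_ne_zero)]
  have h2 : fderiv ℝ (fun x => v x ⬝ᵥ (A k *ᵥ w x)) x = _ := h1.fderiv
  rw [h2]
  simp [EuclideanSpace.inner_single_left]

/-- The `P₀` terms cancel, and the sign `(-1) ^ 1` in the adjoint turns the difference into the two
halves of a product rule. -/
theorem dotProduct_diffOp_sub_dotProduct_diffOpAdjoint (P₀ : Matrix (Fin m) (Fin n) ℝ)
    (P : Fin ℓ → ℕ → Matrix (Fin m) (Fin n) ℝ) (x : EuclideanSpace ℝ (Fin ℓ)) :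
    v x ⬝ᵥ diffOp 1 P₀ P w x - w x ⬝ᵥ diffOpAdjoint 1 P₀ P v x =
      ∑ k, (partialDeriv k v x ⬝ᵥ (P k 1 *ᵥ w x) + v x ⬝ᵥ (P k 1 *ᵥ partialDeriv k w x)) := by
  simp only [diffOp, diffOpAdjoint, Finset.Icc_self, Finset.sum_singleton, Function.iterate_one,
    pow_one, neg_smul, one_smul, dotProduct_add, dotProduct_sum, dotProduct_neg,
    dotProduct_transpose_mulVec, Finset.sum_neg_distrib, Finset.sum_add_distrib]
  ring

theorem inner_greenField_outwardNormal (P : Fin ℓ → ℕ → Matrix (Fin m) (Fin n) ℝ)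
    (s : EuclideanSpace ℝ (Fin ℓ)) :
    ⟪greenField (fun k => P k 1) v w s, outwardNormal S s⟫ =
      w s ⬝ᵥ (boundaryMatrix P S s *ᵥ v s) := by
  rw [boundaryMatrix, Matrix.sum_mulVec, dotProduct_sum, PiLp.inner_apply]
  refine Finset.sum_congr rfl fun k _ => ?_
  simp [greenField, Matrix.smul_mulVec, dotProduct_transpose_mulVec]

end Green

theorem corollary1 {ℓ m n : ℕ} (hℓ : 1 ≤ ℓ)
    (Ω : Set (EuclideanSpace ℝ (Fin ℓ))) (hΩ : IsBoundedLipschitzDomain Ω)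
    (P₀ : Matrix (Fin m) (Fin n) ℝ) (P : Fin ℓ → ℕ → Matrix (Fin m) (Fin n) ℝ)
    (v : EuclideanSpace ℝ (Fin ℓ) → Fin m → ℝ) (w : EuclideanSpace ℝ (Fin ℓ) → Fin n → ℝ)
    (hv : ContinuousOn v (closure Ω)) (hv' : ContDiffOn ℝ 1 v Ω)
    (hw : ContinuousOn w (closure Ω)) (hw' : ContDiffOn ℝ 1 w Ω)
    (hint : IntegrableOn
      (fun x => v x ⬝ᵥ diffOp 1 P₀ P w x - w x ⬝ᵥ diffOpAdjoint 1 P₀ P v x) Ω) :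
    (∀ᵐ s ∂(surfaceMeasure Ω), IsOutwardUnitNormal Ω s (outwardNormal Ω s)) ∧
    Integrable (fun s => w s ⬝ᵥ (boundaryMatrix P Ω s *ᵥ v s)) (surfaceMeasure Ω) ∧
    ∫ x in Ω, (v x ⬝ᵥ diffOp 1 P₀ P w x - w x ⬝ᵥ diffOpAdjoint 1 P₀ P v x) =
      ∫ s, w s ⬝ᵥ (boundaryMatrix P Ω s *ᵥ v s) ∂(surfaceMeasure Ω) := by
  refine ⟨ae_isOutwardUnitNormal hℓ hΩ, ?_⟩
  have hdiv : EqOn (fun x => v x ⬝ᵥ diffOp 1 P₀ P w x - w x ⬝ᵥ diffOpAdjoint 1 P₀ P v x)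
      (divergence (greenField (fun k => P k 1) v w)) Ω := fun x hx => by
    simp only
    rw [dotProduct_diffOp_sub_dotProduct_diffOpAdjoint,
      divergence_greenField (hΩ.isOpen.mem_nhds hx) hv' hw']
  have main := hΩ.setIntegral_divergence hℓ
    (continuousOn_greenField (A := fun k => P k 1) hv hw) (contDiffOn_greenField hv' hw')
    (hint.congr_fun hdiv hΩ.isOpen.measurableSet)
  simp only [inner_greenField_outwardNormal] at main
  rwa [setIntegral_congr_fun hΩ.isOpen.measurableSet hdiv]
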